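/- Let $\lambda\ge 0$, $\sigma_1>0$, $\sigma_2\ge 0$, $\kappa,\rho,\delta>0$ and $\gamma_{\max}>-\lambda\sigma_1^2+\sqrt{\lambda^2\sigma_1^4+\sigma_1^2\sigma_2^2}$. Let $c:[0,\infty)\to[0,\infty)$ be strictly convex, strictly increasing and twice continuously differentiable on $(0,\infty)$ (it then has a continuous derivative $c'$ on $[0,\infty)$, one-sided at $0$). Put $$a_1=\frac{-\delta\rho+\sqrt{\delta^2\rho^2+4\kappa\rho}}{4},\quad a_3=\frac{2a_1\rho}{\delta\rho+\lambda\rho+2a_1},\quad a_2=\frac{a_3(2\rho-a_3)}{2\rho(2\lambda+\delta)},\quad \bar a=a_3-a_2(2\lambda+\delta)=\frac{a_3^2}{2\rho},$$ and $M_0=\gamma_{\max}^2\bar a/\delta$. Assume that $c'(h)\ge M_0$ for some $h\ge 0$, and let $h_{\max}=(c')^{-1}(M_0)$ (with $h_{\max}=0$ if $M_0<c'(0)$). Let $\mathcal A$ be the set of Borel functions $h:[0,\infty)\to[0,h_{\max}]$. For $h\in\mathcal A$ and $\gamma_0\in[0,\gamma_{\max}]$, let $\gamma^{h;\gamma_0}$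 be the absolutely continuous solution on $[0,\infty)$ of $$\dot\gamma_t=-(\sigma_1^{-2}+h_t)\gamma_t^2-2\lambda\gamma_t+\sigma_2^2\quad\text{for a.e. }t,\qquad \gamma_0^{h;\gamma_0}=\gamma_0,$$ and set $$\mathcal J(h;\gamma_0)=\int_0^\infty e^{-\delta t}\bigl(\bar a\,\gamma^{h;\gamma_0}_t+c(h_t)\bigr)\,dt,\qquad v(\gamma_0)=\inf_{h\in\mathcal A}\mathcal J(h;\gamma_0).$$ With $1/0=\infty$, $1/\infty=0$ and $\check\gamma_{\min}=1/\gamma_{\max}$, let $\check v:[\check\gamma_{\min},\infty]\to[0,\infty)$ be the value function of the same problem in the precision variable $\check\gamma=1/\gamma$, that is, $$\check v(\check\gamma_0)=\inf_{h\in\mathcal A}\int_0^\infty e^{-\delta t}\Bigl(\frac{\bar a}{\check\gamma_t}+c(h_t)\Bigr)dt,\qquad \check\gamma_t=1/\gamma_t^{h;1/\check\gamma_0}.$$ Then: 1. $\check v$ is strictly convex on $[\check\gamma_{\min},\infty)$, and also on $[\check\gamma_{\min},\infty]$, that is, $\check v(\alpha x+(1-\alpha)y)<\alpha\check v(x)+(1-\alpha)\check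 v(y)$ for all $x\ne y$ in $[\check\gamma_{\min},\infty]$ and $\alpha\in(0,1)$. 2. $\check v$ is semiconcave with linear modulus on $[\check\gamma_{\min},\infty)$: there is $C>0$ such that $\check v(x+y)+\check v(x-y)-2\check v(x)\le C|y|^2$ for all $x,y\in\mathbb R$ with $x-y,\,x+y\ge\check\gamma_{\min}$. 3. $\check v$ is continuously differentiable on $(\check\gamma_{\min},\infty)$ with Lipschitz continuous derivative. 4. $v$ is continuously differentiable on $(0,\gamma_{\max})$. 5. For every $\gamma_0\in(0,\gamma_{\max}]$ there is exactly one continuous $h^*\in\mathcal A$ with $\mathcal J(h^*;\gamma_0)=v(\gamma_0)$. -/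

import Mathlib

open scoped NNReal ENNReal

noncomputable section

/-- The data of the reduced (deterministic) information acquisition problem:
speed of mean reversion `lam`, volatilities `σ₁`, `σ₂`, cost coefficients `κ`, `ρ`, discount
rate `δ`, maximal conditional variance `γmax`, and information cost `c`
(only its values on `[0, ∞)` matter). -/
structure InfoModel where
  lam : ℝ
  σ₁ : ℝ
  σ₂ : ℝ
  κ : ℝ
  ρ : ℝ
  δ : ℝ
  γmax : ℝ
  c : ℝ → ℝ

namespace InfoModel

variable (P : InfoModel)

/-- The equilibrium `γ⁰_∞` of the uncontrolled conditional variance. -/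
def γinf : ℝ :=
  -P.lam * P.σ₁ ^ 2 + √(P.lam ^ 2 * P.σ₁ ^ 4 + P.σ₁ ^ 2 * P.σ₂ ^ 2)

def a₁ : ℝ := -(P.δ * P.ρ / 4) + √(P.δ ^ 2 * P.ρ ^ 2 + 4 * P.κ * P.ρ) / 4

def a₃ : ℝ := 2 * P.a₁ * P.ρ / (P.δ * P.ρ + P.lam * P.ρ + 2 * P.a₁)

def a₂ : ℝ := P.a₃ * (2 * P.ρ - P.a₃) / (2 * P.ρ * (2 * P.lam + P.δ))

def aBar : ℝ := P.a₃ - P.a₂ * (2 * P.lam + P.δ)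

/-- The marginal cost `c'` on `[0, ∞)`, one-sided at `0`. -/
def marginalCost (h : ℝ) : ℝ := derivWithin P.c (Set.Ici 0) h

def Lv : ℝ := P.aBar / P.δ

def M₀ : ℝ := P.γmax ^ 2 * P.Lv

open Classical in
/-- `h_max = (c')⁻¹(M₀)`, with value `0` if `M₀ < c'(0)`. -/
def hmax : ℝ :=
  if P.M₀ < P.marginalCost 0 then 0
  else Function.invFunOn P.marginalCost (Set.Ici 0) P.M₀

/-- Admissible controls: Borel functions `[0, ∞) → [0, h_max]`. -/
def admissible : Set (ℝ≥0 → ℝ) :=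
  {h | Measurable h ∧ ∀ t, h t ∈ Set.Icc 0 P.hmax}

/-- The drift of the conditional variance. -/
def f (γ h : ℝ) : ℝ :=
  -((1 / P.σ₁) ^ 2 + h) * γ ^ 2 - 2 * P.lam * γ + P.σ₂ ^ 2

/-- `g` is an (absolutely continuous) solution on `[0, ∞)` of `g' = f(g, h)` a.e., `g(0) = γ₀`,
written in integrated form. -/
def IsCondVar (h : ℝ≥0 → ℝ) (γ₀ : ℝ) (g : ℝ≥0 → ℝ) : Prop :=
  Continuous g ∧
    ∀ t : ℝ≥0, g t = γ₀ + ∫ s in (0 : ℝ)..t, P.f (g s.toNNReal) (h s.toNNReal)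

/-- The conditional variance `γ^{h;γ₀}`: the solution of the state equation (which exists and
is unique for `h` admissible and `γ₀ ∈ [0, γmax]`). -/
def condVar (h : ℝ≥0 → ℝ) (γ₀ : ℝ) : ℝ≥0 → ℝ :=
  Classical.epsilon (P.IsCondVar h γ₀)

/-- The running cost. -/
def k (γ h : ℝ) : ℝ := P.aBar * γ + P.c h

/-- The cost functional `𝒥_det(h; γ₀)`. -/
def J (h : ℝ≥0 → ℝ) (γ₀ : ℝ) : ℝ :=
  ∫ t in Set.Ioi (0 : ℝ),
    Real.exp (-P.δ * t) * P.k (P.condVar h γ₀ t.toNNReal) (h t.toNNReal)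

/-- The value function `v` of the reduced problem. -/
def v (γ₀ : ℝ) : ℝ := ⨅ h : P.admissible, P.J h γ₀

/-- `h` is an optimal control for `v(γ₀)`. -/
def IsOptimal (h : ℝ≥0 → ℝ) (γ₀ : ℝ) : Prop :=
  h ∈ P.admissible ∧ P.J h γ₀ = P.v γ₀

/-- The conditional precision `1 / γ^{h;γ₀}` for the initial precision `x = 1 / γ₀`, with the
conventions `1 / 0 = ∞` and `1 / ∞ = 0`. -/
def condPrec (h : ℝ≥0 → ℝ) (x : ℝ≥0∞) (t : ℝ≥0) : ℝ≥0∞ :=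
  (ENNReal.ofReal (P.condVar h x⁻¹.toReal t))⁻¹

/-- The running cost in the precision variable. -/
def kCheck (x : ℝ≥0∞) (h : ℝ) : ℝ := P.k x⁻¹.toReal h

/-- The cost functional in the precision variable. -/
def JCheck (h : ℝ≥0 → ℝ) (x : ℝ≥0∞) : ℝ :=
  ∫ t in Set.Ioi (0 : ℝ),
    Real.exp (-P.δ * t) * P.kCheck (P.condPrec h x t.toNNReal) (h t.toNNReal)

/-- The reparametrized value function, on `[1 / γmax, ∞]`. -/
def vCheck (x : ℝ≥0∞) : ℝ := ⨅ h : P.admissible, P.JCheck h x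

/-- The restriction of the reparametrized value function to finite precisions. -/
def vCheckReal (x : ℝ) : ℝ := P.vCheck (ENNReal.ofReal x)

end InfoModel

/-- Semiconcavity with linear modulus of `u` on a convex set `s ⊆ ℝ`. -/
def SemiconcaveLinearOn (s : Set ℝ) (u : ℝ → ℝ) : Prop :=
  ∃ C : ℝ, 0 < C ∧ ∀ x y : ℝ, x - y ∈ s → x + y ∈ s →
    u (x + y) + u (x - y) - 2 * u x ≤ C * |y| ^ 2

end

/-! In the precision variable X = 1/γ the state equation reads X' = σ₁⁻² + h + 2λX − σ₂²X², and its
right side is jointly concave in (X, h). By comparison X_t is concave in (X₀, h)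
(`state_harmonic_le`). Since x ↦ 1/x is convex and decreasing, γ_t is convex in (X₀, h). As c is
convex, the cost is jointly convex in initial precision and control, and minimizing over the control
leaves a convex function. Strictness comes from the strict harmonic-arithmetic mean inequality at
time 0 (`strictConvexOn_v_inv`). At precision ∞ every proper combination is again ∞, so only v(0) <
v(γ₀) is needed there (`v_zero_lt`).

In the variable γ the drift is concave on [0, γmax], so for a fixed control γ_t is concave in γ₀.
The map x ↦ 1/x is semiconcave on [1/γmax, ∞). Using the optimal control of an intermediate point at
both endpoints shows that v(1/x) − Kx² is concave, with K = āγmax³/δ (`concaveOn_v_inv_sub_sq`). A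
convex function that is also semiconcave is C¹ with Lipschitz derivative, and v inherits C¹
regularity through γ ↦ 1/γ.

Strict convexity of c is uniform on the compact interval [0, h_max], so almost optimal controls are
close in the discounted L¹ norm (`exists_near_optimal_close`). A suitable minimizing sequence
therefore converges almost everywhere, its limit is optimal, and two continuous optimal controls
coincide. For continuity, let q be the costate. The first order condition says that h_t minimizes
c(η) − Q_t η for almost every t, where Q_t = e^{δt} q_t γ_t² is continuous. This minimizer is unique
and continuous in Q_t (`exists_continuous_isOptimal`). -/

/-! ### Locally Lipschitz functions and the comparison principle -/

section Calculus

open MeasureTheory Set Filter Topology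

/-- A locally Lipschitz function is the integral of its almost everywhere derivative. -/
lemma LocallyLipschitz.integral_eq_sub {F f : ℝ → ℝ} (hF : LocallyLipschitz F) {T : ℝ} (hT : 0 ≤ T)
    (hf : ∀ᵐ t, t ∈ Ioo 0 T → HasDerivAt F (f t) t) :
    IntervalIntegrable f volume 0 T ∧ ∫ t in (0 : ℝ)..T, f t = F T - F 0 := by
  obtain ⟨K, hK⟩ := hF.locallyLipschitzOn (s := uIcc 0 T)
    |>.exists_lipschitzOnWith_of_compact isCompact_uIcc
  have hac := hK.absolutelyContinuousOnInterval
  have hT' : ∀ᵐ t : ℝ, t ≠ T := by simp [ae_iff]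
  have hae : ∀ᵐ t, t ∈ uIoc 0 T → deriv F t = f t := by
    filter_upwards [hf, hT'] with t ht htT htm
    rw [uIoc_of_le hT] at htm
    exact (ht ⟨htm.1, lt_of_le_of_ne htm.2 htT⟩).deriv
  refine ⟨(intervalIntegrable_congr_ae ?_).1 hac.intervalIntegrable_deriv, ?_⟩
  · exact (ae_restrict_iff' measurableSet_uIoc).2 hae
  · rw [← hac.integral_deriv_eq_sub]
    exact (intervalIntegral.integral_congr_ae hae).symm

lemma LocallyLipschitz.le_of_ae_deriv_nonpos {F f : ℝ → ℝ} (hF : LocallyLipschitz F) {T : ℝ}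
    (hT : 0 ≤ T) (hf : ∀ᵐ t, t ∈ Ioo 0 T → HasDerivAt F (f t) t ∧ f t ≤ 0) : F T ≤ F 0 := by
  obtain ⟨-, h⟩ := hF.integral_eq_sub hT (by filter_upwards [hf] with t ht htm using (ht htm).1)
  have hT' : ∀ᵐ t : ℝ, t ≠ T := by simp [ae_iff]
  have : ∫ t in (0 : ℝ)..T, f t ≤ 0 := by
    rw [intervalIntegral.integral_of_le hT]
    refine integral_nonpos_of_ae ((ae_restrict_iff' measurableSet_Ioc).2 ?_)
    filter_upwards [hf, hT'] with t ht htT htm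
    exact (ht ⟨htm.1, lt_of_le_of_ne htm.2 htT⟩).2
  linarith

lemma LocallyLipschitz.contDiff_comp {φ w : ℝ → ℝ} (hφ : ContDiff ℝ 1 φ)
    (hw : LocallyLipschitz w) : LocallyLipschitz fun t => φ (w t) :=
  (hφ.locallyLipschitz (𝕂 := ℝ)).comp hw

lemma LocallyLipschitz.add_real {u w : ℝ → ℝ} (hu : LocallyLipschitz u)
    (hw : LocallyLipschitz w) : LocallyLipschitz fun t => u t + w t := by
  have h : ContDiff ℝ 1 (fun p : ℝ × ℝ => p.1 + p.2) := by fun_prop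
  exact (h.locallyLipschitz (𝕂 := ℝ)).comp (hu.prodMk hw)

lemma LocallyLipschitz.sub_real {u w : ℝ → ℝ} (hu : LocallyLipschitz u)
    (hw : LocallyLipschitz w) : LocallyLipschitz fun t => u t - w t := by
  have h : ContDiff ℝ 1 (fun p : ℝ × ℝ => p.1 - p.2) := by fun_prop
  exact (h.locallyLipschitz (𝕂 := ℝ)).comp (hu.prodMk hw)

lemma LocallyLipschitz.mul_real {u w : ℝ → ℝ} (hu : LocallyLipschitz u)
    (hw : LocallyLipschitz w) : LocallyLipschitz fun t => u t * w t := by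
  have h : ContDiff ℝ 1 (fun p : ℝ × ℝ => p.1 * p.2) := by fun_prop
  exact (h.locallyLipschitz (𝕂 := ℝ)).comp (hu.prodMk hw)

lemma LocallyLipschitz.inv_real {u : ℝ → ℝ} (hu : LocallyLipschitz u) (h0 : ∀ t, u t ≠ 0) :
    LocallyLipschitz fun t => (u t)⁻¹ := by
  intro t
  obtain ⟨K, s, hs, hK⟩ := (contDiffAt_inv ℝ (h0 t) (n := 1)).exists_lipschitzOnWith
  obtain ⟨K', s', hs', hK'⟩ := hu t
  refine ⟨K * K', s' ∩ u ⁻¹' s, inter_mem hs' (hu.continuous.continuousAt hs), ?_⟩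
  exact hK.comp (hK'.mono inter_subset_left) fun x hx => hx.2

/-- Squaring removes the kink of the positive part at 0, so the chain rule in the comparison
principle also applies at zeros of `w`. -/
lemma hasDerivAt_max_zero_sq (x : ℝ) :
    HasDerivAt (fun x : ℝ => max x 0 ^ 2) (2 * max x 0) x := by
  rcases lt_trichotomy x 0 with h | rfl | h
  · have : (fun x : ℝ => max x 0 ^ 2) =ᶠ[𝓝 x] fun _ => 0 := by
      filter_upwards [eventually_lt_nhds h] with y hy
      simp [max_eq_right hy.le]
    rw [max_eq_right h.le, mul_zero]
    exact (hasDerivAt_const x 0).congr_of_eventuallyEq this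
  · rw [hasDerivAt_iff_isLittleO]
    simp only [max_self, mul_zero, sub_zero, ne_eq, OfNat.ofNat_ne_zero, not_false_eq_true,
      zero_pow, smul_eq_mul]
    have h2 : (fun x : ℝ => x ^ 2) =o[𝓝 0] fun x => x := by
      simpa using Asymptotics.isLittleO_pow_id (𝕜 := ℝ) one_lt_two
    refine (Asymptotics.IsBigO.of_norm_le fun y => ?_).trans_isLittleO h2
    rw [norm_pow, Real.norm_eq_abs, abs_of_nonneg (le_max_right y 0), ← sq_abs y]
    refine pow_le_pow_left₀ (le_max_right y 0) ?_ 2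
    exact max_le (le_abs_self y) (abs_nonneg y)
  · have : (fun x : ℝ => max x 0 ^ 2) =ᶠ[𝓝 x] fun y => y ^ 2 := by
      filter_upwards [eventually_gt_nhds h] with y hy
      rw [max_eq_left hy.le]
    rw [max_eq_left h.le]
    simpa using (hasDerivAt_pow 2 x).congr_of_eventuallyEq this

/-- Comparison principle: a locally Lipschitz function that starts nonpositive and satisfies
`w' ≤ K w` almost everywhere on `{w > 0}` stays nonpositive. -/
lemma LocallyLipschitz.nonpos_of_ae_deriv_le {w w' : ℝ → ℝ} (hw : LocallyLipschitz w) {T K : ℝ}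
    (hT : 0 ≤ T) (h0 : w 0 ≤ 0)
    (hd : ∀ᵐ t, t ∈ Ioo 0 T → HasDerivAt w (w' t) t ∧ (0 < w t → w' t ≤ K * w t)) : w T ≤ 0 := by
  have hexp : LocallyLipschitz fun t : ℝ => Real.exp (-2 * K * t) := by
    have : ContDiff ℝ 1 fun t : ℝ => Real.exp (-2 * K * t) := by fun_prop
    exact this.locallyLipschitz (𝕂 := ℝ)
  have hsq : LocallyLipschitz fun t => max (w t) 0 ^ 2 :=
    (hw.max_const 0).contDiff_comp (φ := fun x => x ^ 2) (by fun_prop)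
  -- The energy (w⁺)² e^{−2Kt} is nonincreasing and vanishes at time 0.
  have h := (hsq.mul_real hexp).le_of_ae_deriv_nonpos hT
    (f := fun t => 2 * max (w t) 0 * w' t * Real.exp (-2 * K * t) +
      max (w t) 0 ^ 2 * (Real.exp (-2 * K * t) * (-2 * K))) ?_
  · simp only [max_eq_right h0] at h
    have h1 : max (w T) 0 ^ 2 ≤ 0 := by
      have hp := Real.exp_pos (-2 * K * T)
      have : max (w T) 0 ^ 2 * Real.exp (-2 * K * T) ≤ 0 := by simpa using h
      exact nonpos_of_mul_nonpos_left this hp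
    have h2 : max (w T) 0 = 0 := by nlinarith [sq_nonneg (max (w T) 0)]
    exact max_eq_right_iff.1 h2
  · filter_upwards [hd] with t ht htm
    obtain ⟨h1, h2⟩ := ht htm
    refine ⟨?_, ?_⟩
    · have hA := (hasDerivAt_max_zero_sq (w t)).comp t h1
      have hB : HasDerivAt (fun t : ℝ => Real.exp (-2 * K * t))
          (Real.exp (-2 * K * t) * (-2 * K)) t := by
        simpa using ((hasDerivAt_id t).const_mul (-2 * K)).exp
      exact hA.mul hB
    · rcases le_or_gt (w t) 0 with hle | hlt
      · simp [max_eq_right hle]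
      · rw [max_eq_left hlt.le]
        have hp := Real.exp_pos (-2 * K * t)
        have := mul_nonneg hlt.le (sub_nonneg.2 (h2 hlt))
        have := mul_nonneg this hp.le
        nlinarith

/-- A nonnegative integrable continuous function on `[0, ∞)` that is positive at `0` has positive
integral. -/
lemma integral_Ioi_pos_of_continuous {F : ℝ → ℝ} (hF : Continuous F)
    (hi : IntegrableOn F (Ioi 0)) (hnn : ∀ t, 0 < t → 0 ≤ F t) (h0 : 0 < F 0) :
    0 < ∫ t in Ioi (0 : ℝ), F t := by
  rw [setIntegral_pos_iff_support_of_nonneg_ae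
    ((ae_restrict_iff' measurableSet_Ioi).2 (ae_of_all _ hnn)) hi]
  have hop : IsOpen (Function.support F) := hF.isOpen_support
  obtain ⟨ε, hε, hb⟩ := Metric.isOpen_iff.1 hop 0 h0.ne'
  have hsub : Ioo 0 ε ⊆ Function.support F ∩ Ioi 0 := fun t ht =>
    ⟨hb (by simp [abs_of_pos ht.1, ht.2]), ht.1⟩
  refine lt_of_lt_of_le ?_ (measure_mono hsub)
  simp [hε]

end Calculus

/-! ### Semiconcavity, uniform strict convexity and minimizers -/

section ConvexFunctions

open Set Filter Topology

/-- A convex function that becomes concave after subtracting `K x ^ 2` is continuously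
differentiable on the interior, with Lipschitz derivative. -/
lemma ConvexOn.contDiffOn_of_semiconcave {u : ℝ → ℝ} {a K : ℝ} (hK : 0 ≤ K)
    (hu : ConvexOn ℝ (Ici a) u) (hg : ConcaveOn ℝ (Ici a) fun x => u x - K * x ^ 2) :
    ContDiffOn ℝ 1 u (Ioi a) ∧ LipschitzOnWith (2 * K).toNNReal (deriv u) (Ioi a) := by
  have hInt : interior (Ici a) = Ioi a := interior_Ici
  have hsq (x : ℝ) (s : Set ℝ) : HasDerivWithinAt (fun x : ℝ => K * x ^ 2) (K * (2 * x)) s x := by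
    simpa using ((hasDerivAt_pow 2 x).const_mul K).hasDerivWithinAt
  have hconv : ConvexOn ℝ (Ici a) fun x => K * x ^ 2 - u x := by
    have := hg.neg
    refine this.congr fun x _ => ?_
    simp
  have hdiff : ∀ x ∈ Ioi a, DifferentiableAt ℝ u x := by
    intro x hx
    have hx' : x ∈ interior (Ici a) := by rwa [hInt]
    have hr := hu.hasDerivWithinAt_rightDeriv_of_mem_interior hx'
    have hl := hu.hasDerivWithinAt_leftDeriv_of_mem_interior hx'
    -- Both `u` and K x² − `u` are convex. Their left-right derivative inequalities point in
    -- opposite directions for `u`, so the one-sided derivatives agree.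
    have h1 := hu.leftDeriv_le_rightDeriv_of_mem_interior hx'
    have h2 := hconv.leftDeriv_le_rightDeriv_of_mem_interior hx'
    have e1 : derivWithin (fun x => K * x ^ 2 - u x) (Iio x) x = _ :=
      ((hsq x (Iio x)).sub hl).derivWithin (uniqueDiffWithinAt_Iio x)
    have e2 : derivWithin (fun x => K * x ^ 2 - u x) (Ioi x) x = _ :=
      ((hsq x (Ioi x)).sub hr).derivWithin (uniqueDiffWithinAt_Ioi x)
    rw [e1, e2] at h2
    have heq : derivWithin u (Iio x) x = derivWithin u (Ioi x) x := by linarith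
    rw [heq] at hl
    have := hl.Iic_of_Iio.union hr.Ici_of_Ioi
    rw [Iic_union_Ici, hasDerivWithinAt_univ] at this
    exact this.differentiableAt
  have hmono : MonotoneOn (deriv u) (Ioi a) :=
    (hu.subset Ioi_subset_Ici_self (convex_Ioi a)).monotoneOn_deriv hdiff
  have hsq' (x : ℝ) : HasDerivAt (fun x : ℝ => K * x ^ 2) (K * (2 * x)) x := by
    simpa using (hasDerivAt_pow 2 x).const_mul K
  have hmono2 := (hconv.subset Ioi_subset_Ici_self (convex_Ioi a)).monotoneOn_deriv
    fun x hx => (hsq' x).differentiableAt.sub (hdiff x hx)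
  have hlip : LipschitzOnWith (2 * K).toNNReal (deriv u) (Ioi a) := by
    refine LipschitzOnWith.of_dist_le_mul fun x hx y hy => ?_
    wlog hxy : x ≤ y generalizing x y
    · rw [dist_comm, dist_comm x]
      exact this y hy x hx (le_of_not_ge hxy)
    -- Monotonicity of u' and of 2Kx − u' gives 0 ≤ u'(y) − u'(x) ≤ 2K(y − x).
    have h1 := hmono hx hy hxy
    have h2 := hmono2 hx hy hxy
    have e (z : ℝ) (hz : z ∈ Ioi a) :
        deriv (fun x => K * x ^ 2 - u x) z = K * (2 * z) - deriv u z :=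
      ((hsq' z).sub (hdiff z hz).hasDerivAt).deriv
    simp only [e x hx, e y hy] at h2
    rw [Real.dist_eq, Real.dist_eq, abs_sub_comm, abs_of_nonneg (sub_nonneg.2 h1), abs_sub_comm,
      abs_of_nonneg (sub_nonneg.2 hxy), Real.coe_toNNReal _ (by positivity)]
    linarith
  refine ⟨?_, hlip⟩
  rw [show (1 : WithTop ℕ∞) = 0 + 1 from (zero_add 1).symm,
    contDiffOn_succ_iff_deriv_of_isOpen isOpen_Ioi]
  exact ⟨fun x hx => (hdiff x hx).differentiableWithinAt, by simp,
    contDiffOn_zero.2 hlip.continuousOn⟩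

/-- A quantitative form of strict convexity on a compact interval. -/
lemma StrictConvexOn.exists_modulus {c : ℝ → ℝ} {H : ℝ} (hc : StrictConvexOn ℝ (Icc 0 H) c)
    (hcont : ContinuousOn c (Icc 0 H)) {ε : ℝ} (hε : 0 < ε) :
    ∃ K, 0 ≤ K ∧ ∀ a ∈ Icc 0 H, ∀ b ∈ Icc 0 H,
      |a - b| ≤ ε + K * ((c a + c b) / 2 - c ((a + b) / 2)) := by
  have hmid : ∀ a ∈ Icc 0 H, ∀ b ∈ Icc 0 H, (a + b) / 2 ∈ Icc 0 H := fun a ha b hb =>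
    ⟨by linarith [ha.1, hb.1], by linarith [ha.2, hb.2]⟩
  have hΔ : ∀ a ∈ Icc 0 H, ∀ b ∈ Icc 0 H, 0 ≤ (c a + c b) / 2 - c ((a + b) / 2) := by
    intro a ha b hb
    have := hc.convexOn.2 ha hb (by norm_num : (0 : ℝ) ≤ 1 / 2) (by norm_num : (0 : ℝ) ≤ 1 / 2)
      (by norm_num)
    simp only [smul_eq_mul] at this
    rw [show (1 / 2 * a + 1 / 2 * b : ℝ) = (a + b) / 2 by ring] at this
    linarith
  -- On the compact set of pairs at distance at least ε the midpoint gap of `c` has a positive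
  -- minimum η. As |a − b| ≤ H, the constant K = H/η works.
  set S : Set (ℝ × ℝ) := (Icc 0 H ×ˢ Icc 0 H) ∩ {p | ε ≤ |p.1 - p.2|} with hS
  have hSc : IsCompact S := (isCompact_Icc.prod isCompact_Icc).inter_right
    (isClosed_le continuous_const (by fun_prop))
  rcases S.eq_empty_or_nonempty with hemp | hne
  · refine ⟨0, le_rfl, fun a ha b hb => ?_⟩
    by_contra! hlt
    have : (a, b) ∈ S := ⟨⟨ha, hb⟩, by simp only [mem_ofPred_eq]; linarith⟩
    simp [hemp] at this
  · have hcontΔ : ContinuousOn (fun p : ℝ × ℝ => (c p.1 + c p.2) / 2 - c ((p.1 + p.2) / 2)) S := by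
      refine ContinuousOn.sub (ContinuousOn.div_const (ContinuousOn.add ?_ ?_) _) ?_
      · exact hcont.comp continuous_fst.continuousOn fun p hp => hp.1.1
      · exact hcont.comp continuous_snd.continuousOn fun p hp => hp.1.2
      · exact hcont.comp (by fun_prop) fun p hp => hmid _ hp.1.1 _ hp.1.2
    obtain ⟨p, hp, hmin⟩ := hSc.exists_isMinOn hne hcontΔ
    set η := (c p.1 + c p.2) / 2 - c ((p.1 + p.2) / 2) with hη
    have hηpos : 0 < η := by
      have hne' : p.1 ≠ p.2 := by
        intro h
        have := hp.2
        simp only [mem_ofPred_eq, h, sub_self, abs_zero] at this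
        linarith
      have := hc.2 hp.1.1 hp.1.2 hne' (by norm_num : (0 : ℝ) < 1 / 2)
        (by norm_num : (0 : ℝ) < 1 / 2) (by norm_num)
      simp only [smul_eq_mul] at this
      rw [show (1 / 2 * p.1 + 1 / 2 * p.2 : ℝ) = (p.1 + p.2) / 2 by ring] at this
      linarith
    have hH : 0 ≤ H := hp.1.1.1.trans hp.1.1.2
    refine ⟨H / η, by positivity, fun a ha b hb => ?_⟩
    rcases lt_or_ge |a - b| ε with hlt | hge
    · have := mul_nonneg (by positivity : 0 ≤ H / η) (hΔ a ha b hb)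
      linarith
    · have h1 : η ≤ (c a + c b) / 2 - c ((a + b) / 2) := hmin (a := (a, b)) ⟨⟨ha, hb⟩, hge⟩
      have h2 : |a - b| ≤ H := abs_le.2 ⟨by linarith [ha.1, hb.2], by linarith [ha.2, hb.1]⟩
      have h3 : H / η * η ≤ H / η * ((c a + c b) / 2 - c ((a + b) / 2)) := by gcongr
      rw [div_mul_cancel₀ _ hηpos.ne'] at h3
      linarith

/-- The minimizers of `η ↦ c η - q η` over a compact interval are unique and depend continuously
on `q`. -/
lemma StrictConvexOn.exists_continuous_argmin {c : ℝ → ℝ} {H : ℝ} (hH : 0 ≤ H)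
    (hc : StrictConvexOn ℝ (Icc 0 H) c) (hcont : ContinuousOn c (Icc 0 H)) :
    ∃ m : ℝ → ℝ, Continuous m ∧ (∀ q, m q ∈ Icc 0 H) ∧
      (∀ q, ∀ η ∈ Icc 0 H, c (m q) - q * m q ≤ c η - q * η) ∧
      ∀ q, ∀ η ∈ Icc 0 H, c η - q * η ≤ c (m q) - q * m q → η = m q := by
  have hex (q : ℝ) : ∃ m ∈ Icc 0 H, ∀ η ∈ Icc 0 H, c m - q * m ≤ c η - q * η := by
    obtain ⟨m, hm, hmin⟩ := isCompact_Icc.exists_isMinOn (nonempty_Icc.2 hH)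
      (f := fun η => c η - q * η) (hcont.sub (by fun_prop))
    exact ⟨m, hm, fun η hη => hmin hη⟩
  -- Testing both minimizers against their midpoint and adding bounds the midpoint gap of `c` by (q
  -- − q')(a − b)/4.
  have hkey {ε K : ℝ} (hK0 : 0 ≤ K) (hK : ∀ a ∈ Icc 0 H, ∀ b ∈ Icc 0 H,
      |a - b| ≤ ε + K * ((c a + c b) / 2 - c ((a + b) / 2))) {q q' a b : ℝ} (ha : a ∈ Icc 0 H)
      (hb : b ∈ Icc 0 H) (hma : ∀ η ∈ Icc 0 H, c a - q * a ≤ c η - q * η)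
      (hmb : ∀ η ∈ Icc 0 H, c b - q' * b ≤ c η - q' * η) :
      |a - b| ≤ ε + K * (H * |q - q'|) := by
    have hmid : (a + b) / 2 ∈ Icc 0 H := ⟨by linarith [ha.1, hb.1], by linarith [ha.2, hb.2]⟩
    have h1 := hma _ hmid
    have h2 := hmb _ hmid
    have h3 : (q - q') * (a - b) ≤ |q - q'| * H := by
      refine (le_abs_self _).trans ?_
      rw [abs_mul]
      gcongr
      exact abs_le.2 ⟨by linarith [ha.1, hb.2], by linarith [ha.2, hb.1]⟩
    have h4 : 0 ≤ |q - q'| * H := by positivity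
    refine (hK a ha b hb).trans ?_
    gcongr
    nlinarith
  choose m hm hmin using hex
  refine ⟨m, ?_, hm, hmin, fun q η hη hle => ?_⟩
  · rw [Metric.continuous_iff]
    intro q ε hε
    obtain ⟨K, hK0, hK⟩ := hc.exists_modulus hcont (half_pos hε)
    refine ⟨ε / (2 * (K * H + 1)), by positivity, fun q' hq' => ?_⟩
    have h1 := hkey hK0 hK (hm q') (hm q) (hmin q') (hmin q)
    rw [Real.dist_eq] at hq' ⊢
    rw [lt_div_iff₀ (by positivity)] at hq'
    have h2 : 0 ≤ K * H := by positivity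
    have h3 := abs_nonneg (q' - q)
    have h4 : K * (H * |q' - q|) < ε / 2 ∨ K * (H * |q' - q|) = 0 := by
      rcases h3.eq_or_lt with h | h
      · right; rw [← h]; ring
      · left; nlinarith
    rcases h4 with h4 | h4 <;> linarith
  · by_contra hne
    have hpos : 0 < |η - m q| := abs_pos.2 (sub_ne_zero.2 hne)
    -- With q' = q the estimate `hkey` gives |η − m q| ≤ |η − m q|/2.
    obtain ⟨K, hK0, hK⟩ := hc.exists_modulus hcont (half_pos hpos)
    have := hkey (q := q) (q' := q) hK0 hK hη (hm q)
      (fun ξ hξ => hle.trans (hmin q ξ hξ)) (hmin q)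
    simp at this
    linarith

/-- A convex monotone function on `[0, ∞)` has a right derivative at `0`. -/
lemma ConvexOn.differentiableWithinAt_Ici_zero {c : ℝ → ℝ} (hc : ConvexOn ℝ (Ici 0) c)
    (hm : MonotoneOn c (Ici 0)) : DifferentiableWithinAt ℝ c (Ici 0) 0 := by
  have hmono : MonotoneOn (slope c 0) (Ioi 0) :=
    (hc.slope_mono self_mem_Ici).mono fun x hx => ⟨mem_Ici.2 (le_of_lt hx), ne_of_gt hx⟩
  have hbdd : BddBelow (slope c 0 '' Ioi 0) := by
    refine ⟨0, ?_⟩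
    rintro _ ⟨x, hx, rfl⟩
    have hx : 0 < x := hx
    rw [slope_def_field, sub_zero]
    exact div_nonneg (sub_nonneg.2 (hm self_mem_Ici hx.le hx.le)) hx.le
  have h := hmono.tendsto_nhdsGT hbdd
  have hd : HasDerivWithinAt c (sInf (slope c 0 '' Ioi 0)) (Ioi 0) 0 :=
    (hasDerivWithinAt_iff_tendsto_slope' self_notMem_Ioi).2 h
  exact hd.Ici_of_Ioi.differentiableWithinAt

end ConvexFunctions

/-! ### Primitives of bounded measurable functions -/

section Primitive

open MeasureTheory Set Filter Topology

lemma locallyIntegrable_of_abs_le {φ b : ℝ → ℝ} (hm : Measurable φ) (hb : Continuous b)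
    (hφ : ∀ t, |φ t| ≤ b t) : LocallyIntegrable φ :=
  hb.locallyIntegrable.mono hm.aestronglyMeasurable
    (ae_of_all _ fun t => (hφ t).trans (le_abs_self _))

lemma intervalIntegrable_of_abs_le {φ b : ℝ → ℝ} (hm : Measurable φ) (hb : Continuous b)
    (hφ : ∀ t, |φ t| ≤ b t) (x y : ℝ) : IntervalIntegrable φ volume x y :=
  ((locallyIntegrable_of_abs_le hm hb hφ).integrableOn_isCompact isCompact_uIcc).intervalIntegrable

lemma locallyLipschitz_integral {φ b : ℝ → ℝ} (hm : Measurable φ) (hb : Continuous b)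
    (hφ : ∀ t, |φ t| ≤ b t) : LocallyLipschitz fun t => ∫ s in (0 : ℝ)..t, φ s := by
  intro x
  have hii (a b : ℝ) : IntervalIntegrable φ volume a b := intervalIntegrable_of_abs_le hm hb hφ a b
  have hx : ∀ᶠ t in 𝓝 x, b t < b x + 1 :=
    hb.continuousAt.eventually_lt continuousAt_const (by simp)
  obtain ⟨ε, hε, hball⟩ := Metric.eventually_nhds_iff_ball.1 hx
  have hbx : 0 ≤ b x + 1 := by linarith [(abs_nonneg (φ x)).trans (hφ x)]
  refine ⟨(b x + 1).toNNReal, Metric.ball x ε, Metric.ball_mem_nhds x hε,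
    LipschitzOnWith.of_dist_le_mul fun s hs t ht => ?_⟩
  rw [dist_comm, Real.dist_eq, intervalIntegral.integral_interval_sub_left (hii _ _) (hii _ _),
    Real.coe_toNNReal _ hbx, dist_comm, Real.dist_eq]
  rw [← Real.norm_eq_abs]
  refine intervalIntegral.norm_integral_le_of_norm_le_const fun r hr => ?_
  have hr' : r ∈ Metric.ball x ε := by
    have hconv : OrdConnected (Metric.ball x ε) := (convex_ball x ε).ordConnected
    exact hconv.uIcc_subset hs ht (uIoc_subset_uIcc hr)
  exact (hφ r).trans (hball r hr').le

lemma ae_hasDerivAt_integral_zero {φ b : ℝ → ℝ} (hm : Measurable φ) (hb : Continuous b)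
    (hφ : ∀ t, |φ t| ≤ b t) : ∀ᵐ t, HasDerivAt (fun t => ∫ s in (0 : ℝ)..t, φ s) (φ t) t := by
  filter_upwards [LocallyIntegrable.ae_hasDerivAt_integral
    (locallyIntegrable_of_abs_le hm hb hφ)] with t ht
  exact ht 0

/-- The function on `[0, ∞)` given by an integral, extended to `ℝ` by a constant. -/
lemma locallyLipschitz_of_eq_integral {φ b : ℝ → ℝ} (hm : Measurable φ) (hb : Continuous b)
    (hφ : ∀ t, |φ t| ≤ b t) {g : ℝ≥0 → ℝ} {a : ℝ}
    (hg : ∀ t : ℝ≥0, g t = a + ∫ s in (0 : ℝ)..t, φ s) :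
    LocallyLipschitz (fun t : ℝ => g t.toNNReal) ∧ g 0 = a ∧
      ∀ᵐ t : ℝ, 0 < t → HasDerivAt (fun t : ℝ => g t.toNNReal) (φ t) t := by
  have hG : (fun t : ℝ => g t.toNNReal) = fun t => a + ∫ s in (0 : ℝ)..max t 0, φ s := by
    ext t
    rw [hg, Real.coe_toNNReal']
  refine ⟨?_, by simp [hg], ?_⟩
  · rw [hG]
    refine (LocallyLipschitz.const a).add_real ?_
    exact (locallyLipschitz_integral hm hb hφ).comp (LocallyLipschitz.id.max_const 0)
  · filter_upwards [ae_hasDerivAt_integral_zero hm hb hφ] with t ht ht0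
    rw [hG]
    refine (ht.const_add a).congr_of_eventuallyEq ?_
    filter_upwards [eventually_gt_nhds ht0] with s hs
    rw [max_eq_left hs.le]

end Primitive

/-! ### Well-posedness of the state equation -/

namespace InfoModel

open MeasureTheory Set Filter Topology

/-- The consequences of the standing assumptions that the analysis of the control problem uses. -/
structure Regular (P : InfoModel) : Prop where
  lam_nonneg : 0 ≤ P.lam
  δ_pos : 0 < P.δ
  γmax_pos : 0 < P.γmax
  aBar_pos : 0 < P.aBar
  hmax_nonneg : 0 ≤ P.hmax
  f_γmax : P.f P.γmax 0 ≤ 0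
  c_nonneg : ∀ x ∈ Icc 0 P.hmax, 0 ≤ P.c x
  c_convex : StrictConvexOn ℝ (Icc 0 P.hmax) P.c
  c_cont : ContinuousOn P.c (Icc 0 P.hmax)

/-- A (locally Lipschitz) solution on `[0, ∞)` of the state equation, extended to `ℝ`. -/
structure IsState (P : InfoModel) (h : ℝ≥0 → ℝ) (γ₀ : ℝ) (G : ℝ → ℝ) : Prop where
  lip : LocallyLipschitz G
  init : G 0 = γ₀
  deriv : ∀ᵐ t : ℝ, 0 < t → HasDerivAt G (P.f (G t) (h t.toNNReal)) t

variable {P : InfoModel}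

lemma abs_f_le (hP : P.Regular) (γ : ℝ) {h : ℝ} (hh : h ∈ Icc 0 P.hmax) :
    |P.f γ h| ≤ ((1 / P.σ₁) ^ 2 + P.hmax) * γ ^ 2 + 2 * P.lam * |γ| + P.σ₂ ^ 2 := by
  have h1 := hP.lam_nonneg
  have h2 : ((1 / P.σ₁) ^ 2 + h) * γ ^ 2 ≤ ((1 / P.σ₁) ^ 2 + P.hmax) * γ ^ 2 := by
    gcongr; exact hh.2
  have h3 : 0 ≤ ((1 / P.σ₁) ^ 2 + h) * γ ^ 2 := by have := hh.1; positivity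
  have h4 := mul_le_mul_of_nonneg_left (le_abs_self γ) h1
  have h5 := mul_le_mul_of_nonneg_left (neg_abs_le γ) h1
  have h6 := sq_nonneg P.σ₂
  unfold f
  exact abs_le.2 ⟨by linarith, by linarith⟩

lemma f_sub_f (γ γ' h h' : ℝ) : P.f γ h - P.f γ' h' =
    -(((1 / P.σ₁) ^ 2 + h) * (γ + γ') + 2 * P.lam) * (γ - γ') - (h - h') * γ' ^ 2 := by
  unfold f; ring

lemma measurable_f {g h : ℝ → ℝ} (hg : Measurable g) (hh : Measurable h) :
    Measurable fun t => P.f (g t) (h t) := by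
  unfold f; fun_prop

lemma IsCondVar.isState (hP : P.Regular) {h : ℝ≥0 → ℝ} (hh : h ∈ P.admissible) {γ₀ : ℝ}
    {g : ℝ≥0 → ℝ} (hg : P.IsCondVar h γ₀ g) : P.IsState h γ₀ fun t => g t.toNNReal := by
  have hgc : Continuous fun t : ℝ => g t.toNNReal := hg.1.comp continuous_real_toNNReal
  have hgm : Measurable fun t : ℝ => P.f (g t.toNNReal) (h t.toNNReal) :=
    measurable_f hgc.measurable (hh.1.comp measurable_real_toNNReal)
  have hgb : Continuous fun t : ℝ => ((1 / P.σ₁) ^ 2 + P.hmax) * g t.toNNReal ^ 2 +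
      2 * P.lam * |g t.toNNReal| + P.σ₂ ^ 2 :=
    ((continuous_const.mul (hgc.pow 2)).add (continuous_const.mul hgc.abs)).add continuous_const
  obtain ⟨h1, h2, h3⟩ := locallyLipschitz_of_eq_integral hgm hgb
    (fun t => abs_f_le hP _ (hh.2 _)) hg.2
  exact ⟨h1, by simpa using h2, h3⟩

/-- No sign of the solutions is known at this stage, so the growth rate of the difference is
controlled by a bound for G₁ + G₂ on the compact interval [0, T]. -/
lemma IsState.unique (hP : P.Regular) {h : ℝ≥0 → ℝ} (hh : h ∈ P.admissible) {γ₀ : ℝ}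
    {G₁ G₂ : ℝ → ℝ} (h₁ : P.IsState h γ₀ G₁) (h₂ : P.IsState h γ₀ G₂) {T : ℝ} (hT : 0 ≤ T) :
    G₁ T = G₂ T := by
  suffices hle : ∀ G₁ G₂ : ℝ → ℝ, P.IsState h γ₀ G₁ → P.IsState h γ₀ G₂ → G₁ T - G₂ T ≤ 0 by
    linarith [hle G₁ G₂ h₁ h₂, hle G₂ G₁ h₂ h₁]
  clear h₁ h₂ G₁ G₂
  intro G₁ G₂ h₁ h₂
  obtain ⟨C, hC⟩ := (isCompact_Icc (a := 0) (b := T)).exists_bound_of_continuousOn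
    (h₁.lip.continuous.add h₂.lip.continuous).continuousOn
  refine (h₁.lip.sub_real h₂.lip).nonpos_of_ae_deriv_le (K := ((1 / P.σ₁) ^ 2 + P.hmax) * C)
    (w' := fun t => P.f (G₁ t) (h t.toNNReal) - P.f (G₂ t) (h t.toNNReal)) hT
    (by simp [h₁.init, h₂.init]) ?_
  filter_upwards [h₁.deriv, h₂.deriv] with t d₁ d₂ ht
  refine ⟨(d₁ ht.1).sub (d₂ ht.1), fun hpos => ?_⟩
  rw [f_sub_f]
  have hb := abs_le.1 (hC t ⟨ht.1.le, ht.2.le⟩)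
  have hht := hh.2 t.toNNReal
  simp only [Pi.add_apply] at hb
  have hC0 : 0 ≤ C := by linarith [hb.1, hb.2]
  have h3 : -(((1 / P.σ₁) ^ 2 + h t.toNNReal) * (G₁ t + G₂ t) + 2 * P.lam) ≤
      ((1 / P.σ₁) ^ 2 + P.hmax) * C := by
    have e1 : ((1 / P.σ₁) ^ 2 + h t.toNNReal) * (-(G₁ t + G₂ t)) ≤
        ((1 / P.σ₁) ^ 2 + h t.toNNReal) * C :=
      mul_le_mul_of_nonneg_left (by linarith) (by have := hht.1; positivity)
    have e2 : ((1 / P.σ₁) ^ 2 + h t.toNNReal) * C ≤ ((1 / P.σ₁) ^ 2 + P.hmax) * C := by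
      gcongr; exact hht.2
    have := hP.lam_nonneg
    linarith
  have := mul_le_mul_of_nonneg_right h3 hpos.le
  simpa using this

/-- The drift, frozen outside of `[0, γmax]`. -/
noncomputable def truncDrift (P : InfoModel) (γ h : ℝ) : ℝ := P.f (max 0 (min γ P.γmax)) h

lemma clamp_mem (hP : P.Regular) (γ : ℝ) : max 0 (min γ P.γmax) ∈ Icc 0 P.γmax :=
  ⟨le_max_left _ _, max_le hP.γmax_pos.le (min_le_right _ _)⟩

/-- A bound for the drift on `[0, γmax]`. -/
noncomputable def driftBound (P : InfoModel) : ℝ :=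
  ((1 / P.σ₁) ^ 2 + P.hmax) * P.γmax ^ 2 + 2 * P.lam * P.γmax + P.σ₂ ^ 2

/-- A Lipschitz constant for the drift on `[0, γmax]`. -/
noncomputable def driftLip (P : InfoModel) : ℝ :=
  ((1 / P.σ₁) ^ 2 + P.hmax) * (2 * P.γmax) + 2 * P.lam + 1

lemma driftBound_nonneg (hP : P.Regular) : 0 ≤ P.driftBound := by
  have := hP.lam_nonneg; have := hP.γmax_pos; have := hP.hmax_nonneg
  unfold driftBound; positivity

lemma driftLip_pos (hP : P.Regular) : 0 < P.driftLip := by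
  have := hP.lam_nonneg; have := hP.γmax_pos; have := hP.hmax_nonneg
  unfold driftLip; positivity

lemma abs_truncDrift_le (hP : P.Regular) (γ : ℝ) {h : ℝ} (hh : h ∈ Icc 0 P.hmax) :
    |P.truncDrift γ h| ≤ P.driftBound := by
  obtain ⟨h0, h1⟩ := clamp_mem hP γ
  have := hP.lam_nonneg; have := hP.γmax_pos; have := hP.hmax_nonneg
  refine (abs_f_le hP _ hh).trans ?_
  unfold driftBound
  rw [abs_of_nonneg h0]
  gcongr

lemma abs_truncDrift_sub_le (hP : P.Regular) (γ γ' : ℝ) {h : ℝ} (hh : h ∈ Icc 0 P.hmax) :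
    |P.truncDrift γ h - P.truncDrift γ' h| ≤ P.driftLip * |γ - γ'| := by
  obtain ⟨h0, h1⟩ := clamp_mem hP γ
  obtain ⟨h0', h1'⟩ := clamp_mem hP γ'
  have := hP.lam_nonneg; have := hP.γmax_pos; have := hP.hmax_nonneg; have := hh.1
  unfold truncDrift
  rw [f_sub_f, sub_self, zero_mul, sub_zero, abs_mul, abs_neg]
  refine mul_le_mul ?_ ?_ (abs_nonneg _) (driftLip_pos hP).le
  · rw [abs_of_nonneg (by positivity)]
    unfold driftLip
    have : ((1 / P.σ₁) ^ 2 + h) * (max 0 (min γ P.γmax) + max 0 (min γ' P.γmax)) ≤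
        ((1 / P.σ₁) ^ 2 + P.hmax) * (2 * P.γmax) := by
      gcongr
      · exact hh.2
      · linarith
    linarith
  · rw [max_comm, max_comm 0]
    exact (abs_max_sub_max_le_abs _ _ _).trans ((abs_min_sub_min_le_max _ _ _ _).trans (by simp))

lemma measurable_truncDrift {g h : ℝ → ℝ} (hg : Measurable g) (hh : Measurable h) :
    Measurable fun t => P.truncDrift (g t) (h t) :=
  measurable_f (by fun_prop) hh

/-- Picard iteration on all of [0, ∞) at once. The unknown is z = e^{−2Lt} g, a bounded function;
the exponential weight turns the Lipschitz constant L into the contraction factor 1/2. -/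
lemma exists_truncated_solution (hP : P.Regular) {h : ℝ≥0 → ℝ} (hh : h ∈ P.admissible) (γ₀ : ℝ) :
    ∃ g : ℝ≥0 → ℝ, Continuous g ∧
      ∀ t : ℝ≥0, g t = γ₀ + ∫ s in (0 : ℝ)..t, P.truncDrift (g s.toNNReal) (h s.toNNReal) := by
  set L := P.driftLip with hL
  have hLpos : 0 < L := driftLip_pos hP
  set B := P.driftBound with hB
  have hB0 : 0 ≤ B := driftBound_nonneg hP
  let ψ (z : BoundedContinuousFunction ℝ≥0 ℝ) (s : ℝ) : ℝ :=
    P.truncDrift (Real.exp (2 * L * s) * z s.toNNReal) (h s.toNNReal)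
  have hψm (z) : Measurable (ψ z) := by
    refine measurable_truncDrift (Continuous.measurable ?_) (hh.1.comp measurable_real_toNNReal)
    have := z.continuous
    fun_prop
  have hψb (z) (s) : |ψ z s| ≤ B := abs_truncDrift_le hP _ (hh.2 _)
  have hψi (z) (a b) : IntervalIntegrable (ψ z) volume a b :=
    intervalIntegrable_of_abs_le (hψm z) continuous_const (hψb z) a b
  have hψc (z) : Continuous fun t : ℝ => ∫ s in (0 : ℝ)..t, ψ z s :=
    (locallyLipschitz_integral (hψm z) continuous_const (hψb z)).continuous
  -- The bound B/(2L) comes from the linear growth Bt of the integral and s e^{−s} ≤ 1 at s = 2Lt.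
  let A (z : BoundedContinuousFunction ℝ≥0 ℝ) : BoundedContinuousFunction ℝ≥0 ℝ :=
    BoundedContinuousFunction.ofNormedAddCommGroup
      (fun t => Real.exp (-(2 * L * t)) * (γ₀ + ∫ s in (0 : ℝ)..t, ψ z s))
      (by have := hψc z; fun_prop) (|γ₀| + B / (2 * L)) (by
        intro t
        have h1 : |∫ s in (0 : ℝ)..t, ψ z s| ≤ B * t := by
          have := intervalIntegral.norm_integral_le_of_norm_le_const (a := 0) (b := (t : ℝ))
            (f := ψ z) (C := B) fun s _ => hψb z s
          simpa using this
        have h2 : Real.exp (-(2 * L * t)) ≤ 1 := Real.exp_le_one_iff.2 (by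
          have : 0 ≤ L * (t : ℝ) := mul_nonneg hLpos.le t.2
          linarith)
        have h3 : Real.exp (-(2 * L * t)) * (2 * L * t) ≤ 1 := by
          have := Real.add_one_le_exp (2 * L * t)
          rw [Real.exp_neg, inv_mul_le_iff₀ (Real.exp_pos _)]
          linarith
        rw [norm_mul, Real.norm_eq_abs, Real.norm_eq_abs, abs_of_pos (Real.exp_pos _)]
        calc Real.exp (-(2 * L * t)) * |γ₀ + ∫ s in (0 : ℝ)..t, ψ z s|
            ≤ Real.exp (-(2 * L * t)) * (|γ₀| + B * t) := by
              gcongr; exact (abs_add_le _ _).trans (by gcongr)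
          _ = Real.exp (-(2 * L * t)) * |γ₀| +
              B / (2 * L) * (Real.exp (-(2 * L * t)) * (2 * L * t)) := by
              field_simp
          _ ≤ 1 * |γ₀| + B / (2 * L) * 1 := by gcongr
          _ = _ := by ring)
  have hcontr : ContractingWith (1 / 2 : ℝ≥0) A := by
    refine ⟨by norm_num, LipschitzWith.of_dist_le_mul fun z z' => ?_⟩
    rw [BoundedContinuousFunction.dist_le (by positivity)]
    intro t
    have hD : ∀ s : ℝ, |ψ z s - ψ z' s| ≤ L * dist z z' * Real.exp (2 * L * s) := by
      intro s
      refine (abs_truncDrift_sub_le hP _ _ (hh.2 _)).trans ?_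
      rw [← mul_sub, abs_mul, abs_of_pos (Real.exp_pos _)]
      have := BoundedContinuousFunction.dist_coe_le_dist (f := z) (g := z') s.toNNReal
      rw [Real.dist_eq] at this
      have h2 : Real.exp (2 * L * s) * |z s.toNNReal - z' s.toNNReal| ≤
        Real.exp (2 * L * s) * dist z z' := by gcongr
      calc _ ≤ L * (Real.exp (2 * L * s) * dist z z') := mul_le_mul_of_nonneg_left h2 hLpos.le
        _ = _ := by ring
    have hInt : ∫ s in (0 : ℝ)..t, Real.exp (2 * L * s) =
        (Real.exp (2 * L * t) - 1) / (2 * L) := by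
      rw [intervalIntegral.integral_comp_mul_left (fun x => Real.exp x) (by positivity),
        integral_exp]
      simp; ring
    have h1 : |∫ s in (0 : ℝ)..t, (ψ z s - ψ z' s)| ≤
        L * dist z z' * ((Real.exp (2 * L * t) - 1) / (2 * L)) := by
      rw [← hInt, ← intervalIntegral.integral_const_mul]
      exact intervalIntegral.norm_integral_le_of_norm_le (f := fun s => ψ z s - ψ z' s)
        (g := fun s => L * dist z z' * Real.exp (2 * L * s)) t.2 (ae_of_all _ fun s _ => hD s)
        (Continuous.intervalIntegrable (by fun_prop) _ _)
    have h2 : dist (A z t) (A z' t) =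
        Real.exp (-(2 * L * t)) * |∫ s in (0 : ℝ)..t, (ψ z s - ψ z' s)| := by
      rw [intervalIntegral.integral_sub (hψi z _ _) (hψi z' _ _), Real.dist_eq]
      change |Real.exp (-(2 * L * t)) * (γ₀ + ∫ s in (0 : ℝ)..t, ψ z s) -
        Real.exp (-(2 * L * t)) * (γ₀ + ∫ s in (0 : ℝ)..t, ψ z' s)| = _
      rw [← mul_sub, abs_mul, abs_of_pos (Real.exp_pos _), add_sub_add_left_eq_sub]
    rw [h2]
    calc _ ≤ Real.exp (-(2 * L * t)) *
          (L * dist z z' * ((Real.exp (2 * L * t) - 1) / (2 * L))) := by gcongr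
      _ = dist z z' / 2 * (Real.exp (-(2 * L * t)) * Real.exp (2 * L * t) -
          Real.exp (-(2 * L * t))) := by field_simp
      _ ≤ dist z z' / 2 * 1 := by
          gcongr
          rw [← Real.exp_add, neg_add_cancel, Real.exp_zero]
          linarith [Real.exp_pos (-(2 * L * t))]
      _ = _ := by simp; ring
  obtain ⟨z, hz⟩ : ∃ z, A z = z := ⟨_, hcontr.fixedPoint_isFixedPt⟩
  refine ⟨fun t => Real.exp (2 * L * t) * z t, by have := z.continuous; fun_prop, fun t => ?_⟩
  have h1 : z t = Real.exp (-(2 * L * t)) * (γ₀ + ∫ s in (0 : ℝ)..t, ψ z s) := by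
    conv_lhs => rw [← hz]
    rfl
  simp only
  rw [h1, ← mul_assoc, ← Real.exp_add, add_neg_cancel, Real.exp_zero, one_mul]
  congr 1
  refine intervalIntegral.integral_congr fun s hs => ?_
  rw [uIcc_of_le t.coe_nonneg] at hs
  simp only [ψ, Real.coe_toNNReal s hs.1]

/-- Well-posedness of the state equation. -/
lemma exists_isCondVar (hP : P.Regular) {h : ℝ≥0 → ℝ} (hh : h ∈ P.admissible) {γ₀ : ℝ}
    (hγ₀ : γ₀ ∈ Icc 0 P.γmax) :
    ∃ g : ℝ≥0 → ℝ, P.IsCondVar h γ₀ g ∧ ∀ t, g t ∈ Icc 0 P.γmax := by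
  obtain ⟨g, hgc, hg⟩ := exists_truncated_solution hP hh γ₀
  obtain ⟨hlip, hinit, hder⟩ := locallyLipschitz_of_eq_integral
    (measurable_truncDrift (hgc.comp continuous_real_toNNReal).measurable
      (hh.1.comp measurable_real_toNNReal)) continuous_const
    (fun t => abs_truncDrift_le hP _ (hh.2 _)) hg
  -- Below 0 the frozen drift is σ₂² ≥ 0, and above γmax it is at most f(γmax, 0) ≤ 0, so the
  -- interval is invariant and the truncation is never active.
  have hmem : ∀ t, g t ∈ Icc 0 P.γmax := by
    intro T
    have hlow : 0 - g (T : ℝ).toNNReal ≤ 0 := by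
      refine ((LocallyLipschitz.const 0).sub_real hlip).nonpos_of_ae_deriv_le (K := 0) T.2
        (w' := fun t => 0 - P.truncDrift (g t.toNNReal) (h t.toNNReal))
        (by simp [hinit, hγ₀.1]) ?_
      filter_upwards [hder] with t ht htm
      refine ⟨(hasDerivAt_const t 0).sub (ht htm.1), fun hpos => ?_⟩
      have : max 0 (min (g t.toNNReal) P.γmax) = 0 :=
        max_eq_left ((min_le_left _ _).trans (by linarith))
      simp only [truncDrift, this, f]
      nlinarith [sq_nonneg P.σ₂]
    have hup : g (T : ℝ).toNNReal - P.γmax ≤ 0 := by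
      refine (hlip.sub_real (LocallyLipschitz.const _)).nonpos_of_ae_deriv_le (K := 0) T.2
        (w' := fun t => P.truncDrift (g t.toNNReal) (h t.toNNReal) - 0)
        (by simp [hinit, hγ₀.2]) ?_
      filter_upwards [hder] with t ht htm
      refine ⟨(ht htm.1).sub (hasDerivAt_const t _), fun hpos => ?_⟩
      have : max 0 (min (g t.toNNReal) P.γmax) = P.γmax := by
        rw [min_eq_right (by linarith), max_eq_right hP.γmax_pos.le]
      simp only [truncDrift, this]
      have h1 := hP.f_γmax
      have h2 := (hh.2 t.toNNReal).1
      unfold f at h1 ⊢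
      nlinarith [mul_nonneg h2 (sq_nonneg P.γmax)]
    simp only [Real.toNNReal_coe] at hlow hup
    exact ⟨by linarith, by linarith⟩
  refine ⟨g, ⟨hgc, fun t => ?_⟩, hmem⟩
  rw [hg]
  congr 1
  refine intervalIntegral.integral_congr fun s _ => ?_
  obtain ⟨h1, h2⟩ := hmem s.toNNReal
  simp only [truncDrift, min_eq_left h2, max_eq_right h1]

/-- The conditional variance as a function of real time. -/
noncomputable def state (P : InfoModel) (h : ℝ≥0 → ℝ) (γ₀ : ℝ) (t : ℝ) : ℝ := P.condVar h γ₀ t.toNNReal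

lemma isState_state (hP : P.Regular) {h : ℝ≥0 → ℝ} (hh : h ∈ P.admissible) {γ₀ : ℝ}
    (hγ₀ : γ₀ ∈ Icc 0 P.γmax) : P.IsState h γ₀ (P.state h γ₀) := by
  obtain ⟨g, hg, -⟩ := exists_isCondVar hP hh hγ₀
  exact (Classical.epsilon_spec (p := P.IsCondVar h γ₀) ⟨g, hg⟩).isState hP hh

/-- `condVar` is only a choice of solution; uniqueness identifies it with the one constructed inside
the interval. -/
lemma condVar_mem (hP : P.Regular) {h : ℝ≥0 → ℝ} (hh : h ∈ P.admissible) {γ₀ : ℝ}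
    (hγ₀ : γ₀ ∈ Icc 0 P.γmax) (t : ℝ≥0) : P.condVar h γ₀ t ∈ Icc 0 P.γmax := by
  obtain ⟨g, hg, hmem⟩ := exists_isCondVar hP hh hγ₀
  have := (isState_state hP hh hγ₀).unique hP hh (hg.isState hP hh) t.2
  simp only [state, NNReal.val_eq_coe, Real.toNNReal_coe] at this
  rw [this]
  exact hmem t

lemma state_mem (hP : P.Regular) {h : ℝ≥0 → ℝ} (hh : h ∈ P.admissible) {γ₀ : ℝ}
    (hγ₀ : γ₀ ∈ Icc 0 P.γmax) (t : ℝ) : P.state h γ₀ t ∈ Icc 0 P.γmax :=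
  condVar_mem hP hh hγ₀ _

lemma continuous_state (hP : P.Regular) {h : ℝ≥0 → ℝ} (hh : h ∈ P.admissible) {γ₀ : ℝ}
    (hγ₀ : γ₀ ∈ Icc 0 P.γmax) : Continuous (P.state h γ₀) :=
  (isState_state hP hh hγ₀).lip.continuous

end InfoModel

/-! ### Comparison and convexity of the state -/

namespace InfoModel

open MeasureTheory Set Filter Topology

variable {P : InfoModel}

section Comparison

lemma state_zero (hP : P.Regular) {h : ℝ≥0 → ℝ} (hh : h ∈ P.admissible) {γ₀ : ℝ}
    (hγ₀ : γ₀ ∈ Icc 0 P.γmax) : P.state h γ₀ 0 = γ₀ :=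
  (isState_state hP hh hγ₀).init

lemma state_max_zero (h : ℝ≥0 → ℝ) (γ₀ t : ℝ) : P.state h γ₀ (max t 0) = P.state h γ₀ t := by
  unfold state
  rcases le_total t 0 with ht | ht
  · rw [max_eq_right ht, Real.toNNReal_zero, Real.toNNReal_of_nonpos ht]
  · rw [max_eq_left ht]

lemma state_mono (hP : P.Regular) {h : ℝ≥0 → ℝ} (hh : h ∈ P.admissible) {γ₀ γ₁ : ℝ}
    (hγ₀ : γ₀ ∈ Icc 0 P.γmax) (hγ₁ : γ₁ ∈ Icc 0 P.γmax) (hle : γ₀ ≤ γ₁) {T : ℝ} (hT : 0 ≤ T) :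
    P.state h γ₀ T ≤ P.state h γ₁ T := by
  have s₀ := isState_state hP hh hγ₀
  have s₁ := isState_state hP hh hγ₁
  rw [← sub_nonpos]
  refine (s₀.lip.sub_real s₁.lip).nonpos_of_ae_deriv_le (K := 0) hT
    (w' := fun t => P.f (P.state h γ₀ t) (h t.toNNReal) - P.f (P.state h γ₁ t) (h t.toNNReal))
    (by simp [s₀.init, s₁.init, hle]) ?_
  filter_upwards [s₀.deriv, s₁.deriv] with t d₀ d₁ ht
  refine ⟨(d₀ ht.1).sub (d₁ ht.1), fun hpos => ?_⟩
  have m₀ := (state_mem hP hh hγ₀ t).1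
  have m₁ := (state_mem hP hh hγ₁ t).1
  have hht := (hh.2 t.toNNReal).1
  have hl := hP.lam_nonneg
  rw [f_sub_f, sub_self, zero_mul, sub_zero, zero_mul, neg_mul, neg_nonpos]
  exact mul_nonneg (by positivity) hpos.le

/-- On [0, γmax] the drift is at least −Kγ, so the state dominates γ₀ e^{−Kt}. This keeps the
precision finite at all times. -/
lemma state_pos (hP : P.Regular) {h : ℝ≥0 → ℝ} (hh : h ∈ P.admissible) {γ₀ : ℝ}
    (hγ₀ : γ₀ ∈ Ioc 0 P.γmax) (t : ℝ) : 0 < P.state h γ₀ t := by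
  have hγ : γ₀ ∈ Icc 0 P.γmax := ⟨hγ₀.1.le, hγ₀.2⟩
  have s := isState_state hP hh hγ
  set K := P.driftLip with hK
  have hK0 : 0 < K := driftLip_pos hP
  suffices hT : ∀ T, 0 ≤ T → γ₀ * Real.exp (-K * T) - P.state h γ₀ T ≤ 0 by
    rw [← state_max_zero]
    have := mul_pos hγ₀.1 (Real.exp_pos (-K * max t 0))
    linarith [hT (max t 0) (le_max_right _ _)]
  intro T hT
  have hexp : LocallyLipschitz fun t : ℝ => γ₀ * Real.exp (-K * t) := by
    have : ContDiff ℝ 1 fun t : ℝ => γ₀ * Real.exp (-K * t) := by fun_prop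
    exact this.locallyLipschitz (𝕂 := ℝ)
  refine (hexp.sub_real s.lip).nonpos_of_ae_deriv_le (K := 0) hT
    (w' := fun t => γ₀ * (Real.exp (-K * t) * -K) - P.f (P.state h γ₀ t) (h t.toNNReal))
    (by simp [s.init]) ?_
  filter_upwards [s.deriv] with t d ht
  refine ⟨?_, fun hpos => ?_⟩
  · refine HasDerivAt.sub ?_ (d ht.1)
    simpa using ((hasDerivAt_id t).const_mul (-K)).exp.const_mul γ₀
  · obtain ⟨m₀, m₁⟩ := state_mem hP hh hγ t
    obtain ⟨hh0, hh1⟩ := hh.2 t.toNNReal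
    have hl := hP.lam_nonneg
    have hg := hP.γmax_pos
    set G := P.state h γ₀ t
    have e1 : K * G ≤ K * (γ₀ * Real.exp (-K * t)) := by gcongr; linarith
    have e2 : ((1 / P.σ₁) ^ 2 + h t.toNNReal) * G + 2 * P.lam ≤ K := by
      have : ((1 / P.σ₁) ^ 2 + h t.toNNReal) * G ≤
          ((1 / P.σ₁) ^ 2 + P.hmax) * (2 * P.γmax) := by
        have := hP.hmax_nonneg
        gcongr
        linarith
      rw [hK]; unfold driftLip; linarith
    have e3 := mul_le_mul_of_nonneg_right e2 m₀
    have e4 := sq_nonneg P.σ₂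
    unfold f
    nlinarith

/-- The drift is decreasing in γ ≥ 0, so no Gronwall factor appears; only the source term (h − k)γ²
remains. -/
lemma abs_state_sub_le (hP : P.Regular) {h k : ℝ≥0 → ℝ} (hh : h ∈ P.admissible)
    (hk : k ∈ P.admissible) {γ₀ : ℝ} (hγ₀ : γ₀ ∈ Icc 0 P.γmax) {T : ℝ} (hT : 0 ≤ T) :
    |P.state h γ₀ T - P.state k γ₀ T| ≤
      ∫ t in (0 : ℝ)..T, P.γmax ^ 2 * |h t.toNNReal - k t.toNNReal| := by
  suffices hle : ∀ h ∈ P.admissible, ∀ k ∈ P.admissible,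
      P.state h γ₀ T - P.state k γ₀ T -
        ∫ t in (0 : ℝ)..T, P.γmax ^ 2 * |h t.toNNReal - k t.toNNReal| ≤ 0 by
    have h1 := hle h hh k hk
    have h2 := hle k hk h hh
    simp only [abs_sub_comm (k _)] at h2
    exact abs_le.2 ⟨by linarith, by linarith⟩
  clear hh hk h k
  intro h hh k hk
  have s₁ := isState_state hP hh hγ₀
  have s₂ := isState_state hP hk hγ₀
  have hm : Measurable fun t : ℝ => P.γmax ^ 2 * |h t.toNNReal - k t.toNNReal| := by
    have := hh.1; have := hk.1; fun_prop
  have hb : ∀ t : ℝ, |(P.γmax ^ 2 * |h t.toNNReal - k t.toNNReal|)| ≤ P.γmax ^ 2 * P.hmax := by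
    intro t
    obtain ⟨a1, a2⟩ := hh.2 t.toNNReal
    obtain ⟨b1, b2⟩ := hk.2 t.toNNReal
    rw [abs_of_nonneg (by positivity)]
    gcongr
    exact abs_le.2 ⟨by linarith, by linarith⟩
  refine ((s₁.lip.sub_real s₂.lip).sub_real
    (locallyLipschitz_integral hm continuous_const hb)).nonpos_of_ae_deriv_le (K := 0) hT
    (w' := fun t => P.f (P.state h γ₀ t) (h t.toNNReal) - P.f (P.state k γ₀ t) (k t.toNNReal) -
      P.γmax ^ 2 * |h t.toNNReal - k t.toNNReal|) (by simp [s₁.init, s₂.init]) ?_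
  filter_upwards [s₁.deriv, s₂.deriv, ae_hasDerivAt_integral_zero hm continuous_const hb]
    with t d₁ d₂ d₃ ht
  refine ⟨((d₁ ht.1).sub (d₂ ht.1)).sub d₃, fun hpos => ?_⟩
  have hInt : 0 ≤ ∫ t in (0 : ℝ)..t, P.γmax ^ 2 * |h t.toNNReal - k t.toNNReal| :=
    intervalIntegral.integral_nonneg ht.1.le fun s _ => by positivity
  have m₁ := state_mem hP hh hγ₀ t
  have m₂ := state_mem hP hk hγ₀ t
  have hht := (hh.2 t.toNNReal).1
  have hl := hP.lam_nonneg
  have e1 : 0 ≤ (((1 / P.σ₁) ^ 2 + h t.toNNReal) * (P.state h γ₀ t + P.state k γ₀ t) +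
      2 * P.lam) * (P.state h γ₀ t - P.state k γ₀ t) := by
    have := m₁.1; have := m₂.1
    exact mul_nonneg (by positivity) (by linarith)
  have e2 : -(h t.toNNReal - k t.toNNReal) * P.state k γ₀ t ^ 2 ≤
      |h t.toNNReal - k t.toNNReal| * P.γmax ^ 2 :=
    mul_le_mul (neg_le_abs _) (pow_le_pow_left₀ m₂.1 m₂.2 2) (by positivity) (abs_nonneg _)
  rw [f_sub_f]
  linarith

lemma combine_mem_admissible {h k : ℝ≥0 → ℝ} (hh : h ∈ P.admissible) (hk : k ∈ P.admissible)
    {α β : ℝ} (hα : 0 ≤ α) (hβ : 0 ≤ β) (hαβ : α + β = 1) :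
    (fun t => α * h t + β * k t) ∈ P.admissible := by
  refine ⟨by have := hh.1; have := hk.1; fun_prop, fun t => ?_⟩
  exact convex_Icc 0 P.hmax (hh.2 t) (hk.2 t) hα hβ hαβ

lemma harmonic_mem (hP : P.Regular) {γ₁ γ₂ α β : ℝ} (hγ₁ : γ₁ ∈ Ioc 0 P.γmax)
    (hγ₂ : γ₂ ∈ Ioc 0 P.γmax) (hα : 0 ≤ α) (hβ : 0 ≤ β) (hαβ : α + β = 1) :
    (α * γ₁⁻¹ + β * γ₂⁻¹)⁻¹ ∈ Ioc 0 P.γmax := by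
  have h1 : P.γmax⁻¹ ≤ γ₁⁻¹ := inv_anti₀ hγ₁.1 hγ₁.2
  have h2 : P.γmax⁻¹ ≤ γ₂⁻¹ := inv_anti₀ hγ₂.1 hγ₂.2
  have h0 : 0 < P.γmax⁻¹ := inv_pos.2 hP.γmax_pos
  have h3 : P.γmax⁻¹ ≤ α * γ₁⁻¹ + β * γ₂⁻¹ := by
    calc P.γmax⁻¹ = α * P.γmax⁻¹ + β * P.γmax⁻¹ := by rw [← add_mul, hαβ, one_mul]
      _ ≤ _ := by gcongr
  exact ⟨inv_pos.2 (h0.trans_le h3), by simpa using inv_anti₀ h0 h3⟩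

/-- The conditional precision is concave in the pair of initial precision and control. -/
lemma state_harmonic_le (hP : P.Regular) {h₁ h₂ : ℝ≥0 → ℝ} (hh₁ : h₁ ∈ P.admissible)
    (hh₂ : h₂ ∈ P.admissible) {γ₁ γ₂ α β : ℝ} (hγ₁ : γ₁ ∈ Ioc 0 P.γmax)
    (hγ₂ : γ₂ ∈ Ioc 0 P.γmax) (hα : 0 ≤ α) (hβ : 0 ≤ β) (hαβ : α + β = 1) {T : ℝ} (hT : 0 ≤ T) :
    P.state (fun t => α * h₁ t + β * h₂ t) (α * γ₁⁻¹ + β * γ₂⁻¹)⁻¹ T ≤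
      (α * (P.state h₁ γ₁ T)⁻¹ + β * (P.state h₂ γ₂ T)⁻¹)⁻¹ := by
  have hm := harmonic_mem hP hγ₁ hγ₂ hα hβ hαβ
  have hh := combine_mem_admissible hh₁ hh₂ hα hβ hαβ
  set γ := (α * γ₁⁻¹ + β * γ₂⁻¹)⁻¹ with hγ
  set h : ℝ≥0 → ℝ := fun t => α * h₁ t + β * h₂ t with hhdef
  have p₁ := state_pos hP hh₁ hγ₁
  have p₂ := state_pos hP hh₂ hγ₂
  have p := state_pos hP hh hm
  have s₁ := isState_state hP hh₁ (Ioc_subset_Icc_self hγ₁)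
  have s₂ := isState_state hP hh₂ (Ioc_subset_Icc_self hγ₂)
  have s := isState_state hP hh (Ioc_subset_Icc_self hm)
  have hmain : α * (P.state h₁ γ₁ T)⁻¹ + β * (P.state h₂ γ₂ T)⁻¹ - (P.state h γ T)⁻¹ ≤ 0 := by
    have l₁ := s₁.lip.inv_real fun t => (p₁ t).ne'
    have l₂ := s₂.lip.inv_real fun t => (p₂ t).ne'
    have l := s.lip.inv_real fun t => (p t).ne'
    have hl := (((LocallyLipschitz.const α).mul_real l₁).add_real
      ((LocallyLipschitz.const β).mul_real l₂)).sub_real l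
    refine hl.nonpos_of_ae_deriv_le (K := 2 * P.lam) hT
      (w' := fun t => α * (-P.f (P.state h₁ γ₁ t) (h₁ t.toNNReal) / P.state h₁ γ₁ t ^ 2) +
        β * (-P.f (P.state h₂ γ₂ t) (h₂ t.toNNReal) / P.state h₂ γ₂ t ^ 2) -
        -P.f (P.state h γ t) (h t.toNNReal) / P.state h γ t ^ 2)
      (by simp only [s₁.init, s₂.init, s.init]; simp [hγ]) ?_
    filter_upwards [s₁.deriv, s₂.deriv, s.deriv] with t d₁ d₂ d ht
    refine ⟨((((d₁ ht.1).inv (p₁ t).ne').const_mul α).add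
      (((d₂ ht.1).inv (p₂ t).ne').const_mul β)).sub ((d ht.1).inv (p t).ne'), fun hpos => ?_⟩
    -- The drift of the precision X = 1/G: affine in (X, η) apart from the concave term −σ₂²X².
    have e (G η : ℝ) (hG : 0 < G) : -P.f G η / G ^ 2 =
        (1 / P.σ₁) ^ 2 + η + 2 * P.lam * G⁻¹ - P.σ₂ ^ 2 * G⁻¹ ^ 2 := by
      generalize ha : (1 / P.σ₁) ^ 2 = a
      unfold f
      rw [ha]
      field_simp
      ring
    rw [e _ _ (p₁ t), e _ _ (p₂ t), e _ _ (p t)]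
    set X₁ := (P.state h₁ γ₁ t)⁻¹
    set X₂ := (P.state h₂ γ₂ t)⁻¹
    have hX : 0 < (P.state h γ t)⁻¹ := inv_pos.2 (p t)
    set X := (P.state h γ t)⁻¹
    obtain rfl : β = 1 - α := by linarith
    -- Where the averaged precision exceeds X, Jensen's inequality gives the σ₂² terms a favourable
    -- sign, and the linear terms leave the rate 2λ.
    have j1 : (α * X₁ + (1 - α) * X₂) ^ 2 ≤ α * X₁ ^ 2 + (1 - α) * X₂ ^ 2 := by
      nlinarith [mul_nonneg (mul_nonneg hα hβ) (sq_nonneg (X₁ - X₂))]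
    have j2 : X ^ 2 ≤ (α * X₁ + (1 - α) * X₂) ^ 2 := pow_le_pow_left₀ hX.le (by linarith) 2
    have j3 := mul_le_mul_of_nonneg_left (j2.trans j1) (sq_nonneg P.σ₂)
    simp only [hhdef]
    linarith
  have hpos : 0 < α * (P.state h₁ γ₁ T)⁻¹ + β * (P.state h₂ γ₂ T)⁻¹ := by
    have q₁ := inv_pos.2 (p₁ T)
    have q₂ := inv_pos.2 (p₂ T)
    rcases hα.eq_or_lt with rfl | hα'
    · rw [zero_add] at hαβ; subst hαβ; simpa using p₂ T
    · have := mul_nonneg hβ q₂.le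
      have := mul_pos hα' q₁
      linarith
  rw [le_inv_comm₀ (p T) hpos]
  linarith

lemma harmonic_mean_le {a b α β : ℝ} (ha : 0 < a) (hb : 0 < b) (hα : 0 ≤ α) (hβ : 0 ≤ β)
    (hαβ : α + β = 1) : (α * a⁻¹ + β * b⁻¹)⁻¹ ≤ α * a + β * b := by
  have := (convexOn_zpow (𝕜 := ℝ) (-1)).2 (inv_pos.2 ha) (inv_pos.2 hb) hα hβ hαβ
  simpa using this

lemma harmonic_mean_lt {a b α β : ℝ} (ha : 0 < a) (hb : 0 < b) (hab : a ≠ b) (hα : 0 < α)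
    (hβ : 0 < β) (hαβ : α + β = 1) : (α * a⁻¹ + β * b⁻¹)⁻¹ < α * a + β * b := by
  have := (strictConvexOn_zpow (m := -1) (by norm_num) (by norm_num)).2
    (inv_pos.2 ha) (inv_pos.2 hb) (by simpa using hab) hα hβ hαβ
  simpa using this

lemma state_harmonic_le_combination (hP : P.Regular) {h₁ h₂ : ℝ≥0 → ℝ}
    (hh₁ : h₁ ∈ P.admissible) (hh₂ : h₂ ∈ P.admissible) {γ₁ γ₂ α β : ℝ}
    (hγ₁ : γ₁ ∈ Ioc 0 P.γmax) (hγ₂ : γ₂ ∈ Ioc 0 P.γmax) (hα : 0 ≤ α) (hβ : 0 ≤ β)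
    (hαβ : α + β = 1) {T : ℝ} (hT : 0 ≤ T) :
    P.state (fun t => α * h₁ t + β * h₂ t) (α * γ₁⁻¹ + β * γ₂⁻¹)⁻¹ T ≤
      α * P.state h₁ γ₁ T + β * P.state h₂ γ₂ T :=
  (state_harmonic_le hP hh₁ hh₂ hγ₁ hγ₂ hα hβ hαβ hT).trans
    (harmonic_mean_le (state_pos hP hh₁ hγ₁ T) (state_pos hP hh₂ hγ₂ T) hα hβ hαβ)

/-- For a fixed control the conditional variance is concave in its initial value. -/
lemma combination_state_sub_le (hP : P.Regular) {h : ℝ≥0 → ℝ} (hh : h ∈ P.admissible)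
    {γ₀ γ₁ γ₂ α β C : ℝ} (hγ₀ : γ₀ ∈ Icc 0 P.γmax) (hγ₁ : γ₁ ∈ Icc 0 P.γmax)
    (hγ₂ : γ₂ ∈ Icc 0 P.γmax) (hα : 0 ≤ α) (hβ : 0 ≤ β) (hαβ : α + β = 1) (hC : 0 ≤ C)
    (h0 : α * γ₁ + β * γ₂ - γ₀ ≤ C) {T : ℝ} (hT : 0 ≤ T) :
    α * P.state h γ₁ T + β * P.state h γ₂ T - P.state h γ₀ T ≤ C := by
  have s₁ := isState_state hP hh hγ₁
  have s₂ := isState_state hP hh hγ₂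
  have s := isState_state hP hh hγ₀
  have hlip := ((((LocallyLipschitz.const α).mul_real s₁.lip).add_real
      ((LocallyLipschitz.const β).mul_real s₂.lip)).sub_real s.lip).sub_real
      (LocallyLipschitz.const C)
  rw [← sub_nonpos]
  refine hlip.nonpos_of_ae_deriv_le (K := 0) hT
    (w' := fun t => α * P.f (P.state h γ₁ t) (h t.toNNReal) +
      β * P.f (P.state h γ₂ t) (h t.toNNReal) - P.f (P.state h γ₀ t) (h t.toNNReal) - 0)
    (by simp only [s₁.init, s₂.init, s.init]; linarith) ?_
  filter_upwards [s₁.deriv, s₂.deriv, s.deriv] with t d₁ d₂ d ht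
  refine ⟨((((d₁ ht.1).const_mul α).add ((d₂ ht.1).const_mul β)).sub (d ht.1)).sub
    (hasDerivAt_const t C), fun hpos => ?_⟩
  have m := (state_mem hP hh hγ₀ t).1
  have hht := (hh.2 t.toNNReal).1
  have hl := hP.lam_nonneg
  obtain rfl : β = 1 - α := by linarith
  unfold f
  set G₁ := P.state h γ₁ t
  set G₂ := P.state h γ₂ t
  set G := P.state h γ₀ t
  have hA : 0 ≤ (1 / P.σ₁) ^ 2 + h t.toNNReal := by positivity
  set A := (1 / P.σ₁) ^ 2 + h t.toNNReal
  have j1 : (α * G₁ + (1 - α) * G₂) ^ 2 ≤ α * G₁ ^ 2 + (1 - α) * G₂ ^ 2 := by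
    nlinarith [mul_nonneg (mul_nonneg hα hβ) (sq_nonneg (G₁ - G₂))]
  have j2 : G ^ 2 ≤ (α * G₁ + (1 - α) * G₂) ^ 2 := pow_le_pow_left₀ m (by linarith) 2
  have j3 := mul_le_mul_of_nonneg_left (j2.trans j1) hA
  have j4 : 0 ≤ P.lam * (α * G₁ + (1 - α) * G₂ - G) := mul_nonneg hl (by linarith)
  linarith

end Comparison

/-! ### The cost functional and closeness of almost optimal controls -/

section Cost

/-- Reduces cost comparisons to pointwise inequalities of the integrands. Four terms suffice for
every use below; superfluous ones get coefficient 0. -/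
lemma setIntegral_le_combination {φ a b c d : ℝ → ℝ} (hφ : IntegrableOn φ (Ioi 0))
    (ha : IntegrableOn a (Ioi 0)) (hb : IntegrableOn b (Ioi 0)) (hc : IntegrableOn c (Ioi 0))
    (hd : IntegrableOn d (Ioi 0)) (x y z w : ℝ)
    (hle : ∀ t, 0 < t → φ t ≤ x * a t + y * b t + z * c t + w * d t) :
    ∫ t in Ioi (0 : ℝ), φ t ≤ x * (∫ t in Ioi (0 : ℝ), a t) + y * (∫ t in Ioi (0 : ℝ), b t) +
      z * (∫ t in Ioi (0 : ℝ), c t) + w * ∫ t in Ioi (0 : ℝ), d t := by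
  have hxy : IntegrableOn (fun t => x * a t + y * b t) (Ioi 0) :=
    (ha.const_mul x).add (hb.const_mul y)
  have hxyz : IntegrableOn (fun t => x * a t + y * b t + z * c t) (Ioi 0) :=
    hxy.add (hc.const_mul z)
  have hxyzw : IntegrableOn (fun t => x * a t + y * b t + z * c t + w * d t) (Ioi 0) :=
    hxyz.add (hd.const_mul w)
  rw [← integral_const_mul, ← integral_const_mul, ← integral_const_mul, ← integral_const_mul,
    ← integral_add (ha.const_mul x) (hb.const_mul y), ← integral_add hxy (hc.const_mul z),
    ← integral_add hxyz (hd.const_mul w)]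
  exact setIntegral_mono_on hφ hxyzw measurableSet_Ioi hle

lemma integrableOn_discount (hP : P.Regular) :
    IntegrableOn (fun t : ℝ => Real.exp (-P.δ * t)) (Ioi 0) :=
  exp_neg_integrableOn_Ioi 0 hP.δ_pos

lemma integral_discount (hP : P.Regular) :
    ∫ t in Ioi (0 : ℝ), Real.exp (-P.δ * t) = 1 / P.δ := by
  rw [integral_exp_mul_Ioi (by linarith [hP.δ_pos]) 0]
  simp

lemma integrableOn_discount_mul (hP : P.Regular) {φ : ℝ → ℝ} (hm : Measurable φ) {C : ℝ}
    (hb : ∀ t, |φ t| ≤ C) : IntegrableOn (fun t : ℝ => Real.exp (-P.δ * t) * φ t) (Ioi 0) :=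
  (integrableOn_discount hP).mul_bdd hm.aestronglyMeasurable (ae_of_all _ hb)

lemma exists_cost_bound (hP : P.Regular) : ∃ C, ∀ x ∈ Icc 0 P.hmax, |P.c x| ≤ C :=
  isCompact_Icc.exists_bound_of_continuousOn hP.c_cont

lemma measurable_cost (hP : P.Regular) {h : ℝ≥0 → ℝ} (hh : h ∈ P.admissible) :
    Measurable fun t : ℝ => P.c (h t.toNNReal) := by
  -- Continuity of `c` is available only on [0, h_max], so it is replaced by its continuous
  -- extension by constants.
  have h1 : (fun t : ℝ => P.c (h t.toNNReal)) = fun t : ℝ =>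
      IccExtend hP.hmax_nonneg ((Icc 0 P.hmax).domRestrict P.c) (h t.toNNReal) := by
    ext t
    rw [IccExtend_of_mem _ _ (hh.2 _)]
    rfl
  rw [h1]
  have h2 : Continuous (IccExtend hP.hmax_nonneg ((Icc 0 P.hmax).domRestrict P.c)) :=
    (continuousOn_iff_continuous_domRestrict.1 hP.c_cont).Icc_extend'
  exact h2.measurable.comp (hh.1.comp measurable_real_toNNReal)

lemma measurable_running (hP : P.Regular) {h : ℝ≥0 → ℝ} (hh : h ∈ P.admissible) {γ₀ : ℝ}
    (hγ₀ : γ₀ ∈ Icc 0 P.γmax) :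
    Measurable fun t : ℝ => P.aBar * P.state h γ₀ t + P.c (h t.toNNReal) :=
  ((continuous_state hP hh hγ₀).measurable.const_mul _).add (measurable_cost hP hh)

lemma exists_running_bound (hP : P.Regular) : ∃ C, ∀ h ∈ P.admissible, ∀ γ₀ ∈ Icc 0 P.γmax,
    ∀ t : ℝ, |P.aBar * P.state h γ₀ t + P.c (h t.toNNReal)| ≤ C := by
  obtain ⟨C, hC⟩ := exists_cost_bound hP
  refine ⟨P.aBar * P.γmax + C, fun h hh γ₀ hγ₀ t => (abs_add_le _ _).trans ?_⟩
  have := hC _ (hh.2 t.toNNReal)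
  obtain ⟨m1, m2⟩ := state_mem hP hh hγ₀ t
  have ha := hP.aBar_pos
  rw [abs_of_nonneg (by positivity)]
  gcongr

lemma J_eq (h : ℝ≥0 → ℝ) (γ₀ : ℝ) : P.J h γ₀ = ∫ t in Ioi (0 : ℝ),
    Real.exp (-P.δ * t) * (P.aBar * P.state h γ₀ t + P.c (h t.toNNReal)) := rfl

lemma integrableOn_running (hP : P.Regular) {h : ℝ≥0 → ℝ} (hh : h ∈ P.admissible) {γ₀ : ℝ}
    (hγ₀ : γ₀ ∈ Icc 0 P.γmax) : IntegrableOn (fun t : ℝ =>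
      Real.exp (-P.δ * t) * (P.aBar * P.state h γ₀ t + P.c (h t.toNNReal))) (Ioi 0) := by
  obtain ⟨C, hC⟩ := exists_running_bound hP
  exact integrableOn_discount_mul hP (measurable_running hP hh hγ₀) (hC h hh γ₀ hγ₀)

lemma J_nonneg (hP : P.Regular) {h : ℝ≥0 → ℝ} (hh : h ∈ P.admissible) {γ₀ : ℝ}
    (hγ₀ : γ₀ ∈ Icc 0 P.γmax) : 0 ≤ P.J h γ₀ := by
  rw [J_eq]
  refine integral_nonneg fun t => mul_nonneg (Real.exp_pos _).le ?_
  have := (state_mem hP hh hγ₀ t).1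
  have := hP.c_nonneg _ (hh.2 t.toNNReal)
  have := hP.aBar_pos
  positivity

lemma v_le (hP : P.Regular) {h : ℝ≥0 → ℝ} (hh : h ∈ P.admissible) {γ₀ : ℝ}
    (hγ₀ : γ₀ ∈ Icc 0 P.γmax) : P.v γ₀ ≤ P.J h γ₀ := by
  have hb : BddBelow (range fun h : P.admissible => P.J h γ₀) := by
    refine ⟨0, ?_⟩
    rintro _ ⟨k, rfl⟩
    exact J_nonneg hP k.2 hγ₀
  exact ciInf_le hb ⟨h, hh⟩

lemma zero_mem_admissible (hP : P.Regular) : (fun _ => 0) ∈ P.admissible :=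
  ⟨measurable_const, fun _ => ⟨le_rfl, hP.hmax_nonneg⟩⟩

lemma exists_J_lt (hP : P.Regular) {γ₀ η : ℝ} (hη : 0 < η) :
    ∃ h ∈ P.admissible, P.J h γ₀ < P.v γ₀ + η := by
  have : Nonempty P.admissible := ⟨⟨_, zero_mem_admissible hP⟩⟩
  obtain ⟨h, hh⟩ := exists_lt_of_ciInf_lt (f := fun h : P.admissible => P.J h γ₀)
    (lt_add_of_pos_right (P.v γ₀) hη)
  exact ⟨h, h.2, hh⟩

lemma integrableOn_discount_abs_sub (hP : P.Regular) {h k : ℝ≥0 → ℝ} (hh : h ∈ P.admissible)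
    (hk : k ∈ P.admissible) : IntegrableOn (fun t : ℝ =>
      Real.exp (-P.δ * t) * |h t.toNNReal - k t.toNNReal|) (Ioi 0) := by
  refine integrableOn_discount_mul hP (C := P.hmax) ?_ fun t => ?_
  · have := hh.1; have := hk.1; fun_prop
  · obtain ⟨a1, a2⟩ := hh.2 t.toNNReal
    obtain ⟨b1, b2⟩ := hk.2 t.toNNReal
    rw [abs_abs]
    exact abs_le.2 ⟨by linarith, by linarith⟩

/-- Almost optimal controls are close to each other. -/
lemma exists_near_optimal_close (hP : P.Regular) {γ₀ : ℝ} (hγ₀ : γ₀ ∈ Ioc 0 P.γmax) {ε : ℝ}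
    (hε : 0 < ε) : ∃ η > 0, ∀ h ∈ P.admissible, ∀ k ∈ P.admissible,
      P.J h γ₀ < P.v γ₀ + η → P.J k γ₀ < P.v γ₀ + η →
      ∫ t in Ioi (0 : ℝ), Real.exp (-P.δ * t) * |h t.toNNReal - k t.toNNReal| < ε := by
  have hδ := hP.δ_pos
  -- Since the discount factor has integral 1/δ, the modulus contributes ε/2; the choice of η below
  -- makes the other part Kη < ε/2.
  obtain ⟨K, hK0, hK⟩ := hP.c_convex.exists_modulus hP.c_cont (ε := ε * P.δ / 2) (by positivity)
  refine ⟨ε / (2 * (K + 1)), by positivity, fun h hh k hk hJh hJk => ?_⟩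
  set η := ε / (2 * (K + 1)) with hη
  have hγ := Ioc_subset_Icc_self hγ₀
  have hhalf : (0 : ℝ) ≤ 1 / 2 := by norm_num
  have hm := combine_mem_admissible hh hk hhalf hhalf (by norm_num)
  set m : ℝ≥0 → ℝ := fun t => 1 / 2 * h t + 1 / 2 * k t with hmdef
  have hγm : ((1 / 2 : ℝ) * γ₀⁻¹ + 1 / 2 * γ₀⁻¹)⁻¹ = γ₀ := by
    rw [← add_mul]; norm_num
  have ih := integrableOn_running hP hh hγ
  have ik := integrableOn_running hP hk hγ
  have im := integrableOn_running hP hm hγ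
  have hv := v_le hP hm hγ
  -- Convexity of the state in the control bounds the midpoint gap of `c` by that of the running
  -- cost. Its integral is less than η, because the midpoint control costs at least `P.v γ₀`.
  have hkey : ∫ t in Ioi (0 : ℝ), Real.exp (-P.δ * t) * |h t.toNNReal - k t.toNNReal| ≤
      ε * P.δ / 2 * (1 / P.δ) + K * ((P.J h γ₀ + P.J k γ₀) / 2 - P.J m γ₀) := by
    refine (setIntegral_le_combination (integrableOn_discount_abs_sub hP hh hk)
      (integrableOn_discount hP) ih ik im (ε * P.δ / 2) (K / 2) (K / 2) (-K) fun t ht => ?_).trans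
      (le_of_eq (by rw [integral_discount hP, J_eq, J_eq, J_eq]; ring))
    have h1 := hK _ (hh.2 t.toNNReal) _ (hk.2 t.toNNReal)
    have h2 := state_harmonic_le_combination hP hh hk hγ₀ hγ₀ hhalf hhalf (by norm_num)
      (le_of_lt ht)
    rw [hγm] at h2
    have h3 : P.c (m t.toNNReal) = P.c ((h t.toNNReal + k t.toNNReal) / 2) := by
      rw [hmdef]; ring_nf
    have h4 : 0 ≤ P.aBar * ((P.state h γ₀ t + P.state k γ₀ t) / 2 - P.state m γ₀ t) :=
      mul_nonneg hP.aBar_pos.le (by linarith)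
    have h5 := mul_nonneg hK0 h4
    have hE := Real.exp_pos (-P.δ * t)
    have h6 : |h t.toNNReal - k t.toNNReal| ≤ ε * P.δ / 2 +
        K * ((P.aBar * P.state h γ₀ t + P.c (h t.toNNReal) +
          (P.aBar * P.state k γ₀ t + P.c (k t.toNNReal))) / 2 -
          (P.aBar * P.state m γ₀ t + P.c (m t.toNNReal))) := by
      rw [h3]; linarith
    have h7 := mul_le_mul_of_nonneg_left h6 hE.le
    refine h7.trans (le_of_eq ?_)
    ring
  have h8 : K * ((P.J h γ₀ + P.J k γ₀) / 2 - P.J m γ₀) ≤ K * η := by gcongr; linarith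
  have h9 : K * η < ε / 2 := by
    rw [hη, mul_div_assoc', div_lt_div_iff₀ (by positivity) (by norm_num)]
    nlinarith
  have h10 : ε * P.δ / 2 * (1 / P.δ) = ε / 2 := by field_simp
  linarith

end Cost

end InfoModel

/-! ### Existence of an optimal control -/

namespace InfoModel

open MeasureTheory Set Filter Topology

variable {P : InfoModel}

section Existence

lemma tendsto_state_of_ae_tendsto (hP : P.Regular) {γ₀ : ℝ} (hγ₀ : γ₀ ∈ Icc 0 P.γmax)
    {k : ℕ → ℝ≥0 → ℝ} {h : ℝ≥0 → ℝ} (hk : ∀ n, k n ∈ P.admissible) (hh : h ∈ P.admissible)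
    (hlim : ∀ᵐ t : ℝ, 0 < t → Tendsto (fun n => k n t.toNNReal) atTop (𝓝 (h t.toNNReal)))
    {T : ℝ} (hT : 0 < T) :
    Tendsto (fun n => P.state (k n) γ₀ T) atTop (𝓝 (P.state h γ₀ T)) := by
  have hInt : Tendsto (fun n => ∫ t in (0 : ℝ)..T, P.γmax ^ 2 * |k n t.toNNReal - h t.toNNReal|)
      atTop (𝓝 (∫ t in (0 : ℝ)..T, (0 : ℝ))) := by
    refine intervalIntegral.tendsto_integral_filter_of_dominated_convergence
      (fun _ => P.γmax ^ 2 * P.hmax) ?_ ?_ intervalIntegrable_const ?_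
    · refine Eventually.of_forall fun n => Measurable.aestronglyMeasurable ?_
      have := (hk n).1; have := hh.1; fun_prop
    · refine Eventually.of_forall fun n => ae_of_all _ fun t _ => ?_
      obtain ⟨a1, a2⟩ := (hk n).2 t.toNNReal
      obtain ⟨b1, b2⟩ := hh.2 t.toNNReal
      rw [Real.norm_of_nonneg (by positivity)]
      gcongr
      exact abs_le.2 ⟨by linarith, by linarith⟩
    · filter_upwards [hlim] with t ht htm
      rw [uIoc_of_le hT.le] at htm
      have := ((ht htm.1).sub_const (h t.toNNReal)).abs.const_mul (P.γmax ^ 2)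
      simpa using this
  rw [intervalIntegral.integral_zero] at hInt
  rw [tendsto_iff_dist_tendsto_zero]
  exact squeeze_zero (fun _ => dist_nonneg)
    (fun n => abs_state_sub_le hP (hk n) hh hγ₀ hT.le) hInt

/-- The cost is continuous along almost everywhere convergent sequences of controls. -/
lemma tendsto_J_of_ae_tendsto (hP : P.Regular) {γ₀ : ℝ} (hγ₀ : γ₀ ∈ Icc 0 P.γmax)
    {k : ℕ → ℝ≥0 → ℝ} {h : ℝ≥0 → ℝ} (hk : ∀ n, k n ∈ P.admissible) (hh : h ∈ P.admissible)
    (hlim : ∀ᵐ t : ℝ, 0 < t → Tendsto (fun n => k n t.toNNReal) atTop (𝓝 (h t.toNNReal))) :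
    Tendsto (fun n => P.J (k n) γ₀) atTop (𝓝 (P.J h γ₀)) := by
  obtain ⟨C, hC⟩ := exists_running_bound hP
  simp only [J_eq]
  refine tendsto_integral_of_dominated_convergence (fun t => Real.exp (-P.δ * t) * C)
    (fun n => (integrableOn_running hP (hk n) hγ₀).aestronglyMeasurable)
    ((integrableOn_discount hP).mul_const C) (fun n => ae_of_all _ fun t => ?_) ?_
  · rw [norm_mul, Real.norm_of_nonneg (Real.exp_pos _).le]
    gcongr
    exact hC _ (hk n) _ hγ₀ t
  · refine (ae_restrict_iff' measurableSet_Ioi).2 ?_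
    filter_upwards [hlim] with t ht ht0
    refine ((tendsto_state_of_ae_tendsto hP hγ₀ hk hh hlim ht0).const_mul _ |>.add ?_).const_mul _
    have hc : Tendsto P.c (𝓝[Icc 0 P.hmax] (h t.toNNReal)) (𝓝 (P.c (h t.toNNReal))) :=
      hP.c_cont _ (hh.2 _)
    exact hc.comp (tendsto_nhdsWithin_iff.2 ⟨ht ht0, Eventually.of_forall fun n => (hk n).2 _⟩)

/-- A minimizing sequence of controls that converges almost everywhere. -/
lemma exists_minimizing_sequence (hP : P.Regular) {γ₀ : ℝ} (hγ₀ : γ₀ ∈ Ioc 0 P.γmax) :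
    ∃ k : ℕ → ℝ≥0 → ℝ, (∀ n, k n ∈ P.admissible) ∧
      Tendsto (fun n => P.J (k n) γ₀) atTop (𝓝 (P.v γ₀)) ∧
      ∀ᵐ t : ℝ, 0 < t → ∃ l, Tendsto (fun n => k n t.toNNReal) atTop (𝓝 l) := by
  have hη (n : ℕ) := exists_near_optimal_close hP hγ₀ (ε := (1 / 2 : ℝ) ^ n) (by positivity)
  choose η hη0 hη using hη
  -- The running minimum makes every k n with n ≥ N almost optimal at level η N, so all pairs in the
  -- tail are within 2^{−N}.
  let θ (n : ℕ) : ℝ := (Finset.range (n + 1)).inf' ⟨0, by simp⟩ η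
  have hθ0 (n : ℕ) : 0 < θ n := (Finset.lt_inf'_iff _).2 fun i _ => hη0 i
  have hθ {N n : ℕ} (h : N ≤ n) : θ n ≤ η N := Finset.inf'_le _ (by simp; omega)
  have hex (n : ℕ) := exists_J_lt hP (γ₀ := γ₀)
    (lt_min (hθ0 n) (by positivity : (0 : ℝ) < 1 / (n + 1)))
  choose k hk hJ using hex
  refine ⟨k, hk, ?_, ?_⟩
  · refine tendsto_of_tendsto_of_tendsto_of_le_of_le tendsto_const_nhds
      (h := fun n : ℕ => P.v γ₀ + 1 / ((n : ℝ) + 1)) ?_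
      (fun n => v_le hP (hk n) (Ioc_subset_Icc_self hγ₀))
      (fun n => (hJ n).le.trans (add_le_add le_rfl (min_le_right _ _)))
    simpa using tendsto_one_div_add_atTop_nhds_zero_nat.const_add (P.v γ₀)
  · have hi (n : ℕ) : IntegrableOn (fun t : ℝ => Real.exp (-P.δ * t) * k n t.toNNReal) (Ioi 0) :=
      integrableOn_discount_mul hP ((hk n).1.comp measurable_real_toNNReal) (C := P.hmax)
        fun t => by
          obtain ⟨a1, a2⟩ := (hk n).2 t.toNNReal
          rwa [abs_of_nonneg a1]
    -- Summability of the Cauchy rates gives almost everywhere convergence without passing to a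
    -- subsequence.
    have hae := Lp.ae_tendsto_of_cauchy_eLpNorm (μ := volume.restrict (Ioi (0 : ℝ))) (p := 1)
      (f := fun n t => Real.exp (-P.δ * t) * k n t.toNNReal)
      (fun n => (hi n).aestronglyMeasurable) le_rfl
      (B := fun n => ENNReal.ofReal ((1 / 2 : ℝ) ^ n)) summable_geometric_two.tsum_ofReal_ne_top
      (by
        intro N n m hn hm
        rw [eLpNorm_one_eq_lintegral_enorm, ← ofReal_integral_norm_eq_lintegral_enorm
          ((hi n).sub (hi m))]
        refine (ENNReal.ofReal_lt_ofReal_iff (by positivity)).2 ?_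
        have := hη N (k n) (hk n) (k m) (hk m)
          ((hJ n).trans_le (add_le_add le_rfl ((min_le_left _ _).trans (hθ hn))))
          ((hJ m).trans_le (add_le_add le_rfl ((min_le_left _ _).trans (hθ hm))))
        refine lt_of_eq_of_lt (integral_congr_ae (ae_of_all _ fun t => ?_)) this
        simp only [Pi.sub_apply, ← mul_sub, norm_mul, Real.norm_eq_abs]
        rw [abs_of_pos (Real.exp_pos _)])
    filter_upwards [(ae_restrict_iff' measurableSet_Ioi).1 hae] with t ht ht0
    obtain ⟨l, hl⟩ := ht ht0
    refine ⟨Real.exp (P.δ * t) * l, (hl.const_mul (Real.exp (P.δ * t))).congr fun n => ?_⟩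
    rw [← mul_assoc, ← Real.exp_add]
    simp

lemma exists_isOptimal (hP : P.Regular) {γ₀ : ℝ} (hγ₀ : γ₀ ∈ Ioc 0 P.γmax) :
    ∃ h, P.IsOptimal h γ₀ := by
  obtain ⟨k, hk, hJ, hlim⟩ := exists_minimizing_sequence hP hγ₀
  -- The clipped limsup is measurable and has values in [0, h_max] even where the sequence diverges.
  let h : ℝ≥0 → ℝ := fun t => max 0 (min (limsup (fun n => k n t) atTop) P.hmax)
  have hh : h ∈ P.admissible := by
    refine ⟨?_, fun t => ⟨le_max_left _ _, max_le hP.hmax_nonneg (min_le_right _ _)⟩⟩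
    have : Measurable fun t => limsup (fun n => k n t) atTop := .limsup fun n => (hk n).1
    fun_prop
  refine ⟨h, hh, tendsto_nhds_unique (tendsto_J_of_ae_tendsto hP (Ioc_subset_Icc_self hγ₀) hk hh
    ?_) hJ⟩
  filter_upwards [hlim] with t ht ht0
  obtain ⟨l, hl⟩ := ht ht0
  have hl' : l ∈ Icc 0 P.hmax :=
    isClosed_Icc.mem_of_tendsto hl (Eventually.of_forall fun n => (hk n).2 _)
  have : h t.toNNReal = l := by
    simp only [h, hl.limsup_eq, min_eq_left hl'.2, max_eq_right hl'.1]
  rwa [this]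

end Existence

end InfoModel

/-! ### The costate and linearization of the cost -/

namespace InfoModel

open MeasureTheory Set Filter Topology

variable {P : InfoModel}

section Costate

/-- The logarithmic rate of the linearized state equation. -/
noncomputable def linRate (P : InfoModel) (h : ℝ≥0 → ℝ) (γ₀ t : ℝ) : ℝ :=
  2 * ((1 / P.σ₁) ^ 2 + h t.toNNReal) * P.state h γ₀ t + 2 * P.lam

lemma measurable_linRate (hP : P.Regular) {h : ℝ≥0 → ℝ} (hh : h ∈ P.admissible) {γ₀ : ℝ}
    (hγ₀ : γ₀ ∈ Icc 0 P.γmax) : Measurable (P.linRate h γ₀) := by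
  have := hh.1; have := (continuous_state hP hh hγ₀).measurable
  unfold linRate; fun_prop

lemma linRate_nonneg (hP : P.Regular) {h : ℝ≥0 → ℝ} (hh : h ∈ P.admissible) {γ₀ : ℝ}
    (hγ₀ : γ₀ ∈ Icc 0 P.γmax) (t : ℝ) : 0 ≤ P.linRate h γ₀ t := by
  have := (hh.2 t.toNNReal).1; have := (state_mem hP hh hγ₀ t).1; have := hP.lam_nonneg
  unfold linRate; positivity

lemma abs_linRate_le (hP : P.Regular) {h : ℝ≥0 → ℝ} (hh : h ∈ P.admissible) {γ₀ : ℝ}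
    (hγ₀ : γ₀ ∈ Icc 0 P.γmax) (t : ℝ) : |P.linRate h γ₀ t| ≤ P.driftLip := by
  rw [abs_of_nonneg (linRate_nonneg hP hh hγ₀ t)]
  have h1 := hh.2 t.toNNReal
  have h2 := state_mem hP hh hγ₀ t
  have h3 := hP.hmax_nonneg
  have : ((1 / P.σ₁) ^ 2 + h t.toNNReal) * P.state h γ₀ t ≤
      ((1 / P.σ₁) ^ 2 + P.hmax) * P.γmax := by
    gcongr
    · exact h2.1
    · exact h1.2
    · exact h2.2
  unfold linRate driftLip
  linarith

/-- The discounted costate: the bounded solution of the adjoint equation. -/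
lemma exists_costate (hP : P.Regular) {h : ℝ≥0 → ℝ} (hh : h ∈ P.admissible) {γ₀ : ℝ}
    (hγ₀ : γ₀ ∈ Icc 0 P.γmax) : ∃ q : ℝ → ℝ, LocallyLipschitz q ∧
      (∀ t, 0 ≤ t → 0 ≤ q t ∧ q t ≤ P.aBar / P.δ * Real.exp (-P.δ * t)) ∧
      ∀ᵐ t, HasDerivAt q (-(P.aBar * Real.exp (-P.δ * t)) + P.linRate h γ₀ t * q t) t := by
  have hδ := hP.δ_pos
  have ha := hP.aBar_pos
  have hm := measurable_linRate hP hh hγ₀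
  have hb := abs_linRate_le hP hh hγ₀
  set I : ℝ → ℝ := fun t => ∫ s in (0 : ℝ)..t, P.linRate h γ₀ s with hI
  have hIl : LocallyLipschitz I := locallyLipschitz_integral hm continuous_const hb
  have hImono : Monotone I := by
    intro s t hst
    have := intervalIntegral.integral_interval_sub_left (a := (0 : ℝ)) (b := t) (c := s)
      (intervalIntegrable_of_abs_le hm continuous_const hb _ _)
      (intervalIntegrable_of_abs_le hm continuous_const hb _ _)
    have h2 : 0 ≤ ∫ r in s..t, P.linRate h γ₀ r :=
      intervalIntegral.integral_nonneg hst fun r _ => linRate_nonneg hP hh hγ₀ r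
    simp only [hI]
    linarith
  set φ : ℝ → ℝ := fun t => P.aBar * Real.exp (-P.δ * t) * Real.exp (-I t) with hφ
  have hφc : Continuous φ := by
    have := hIl.continuous
    fun_prop
  have hφle (t r : ℝ) (htr : t ≤ r) : φ r ≤ P.aBar * Real.exp (-I t) * Real.exp (-P.δ * r) := by
    have : Real.exp (-I r) ≤ Real.exp (-I t) := Real.exp_le_exp.2 (neg_le_neg (hImono htr))
    calc φ r ≤ P.aBar * Real.exp (-P.δ * r) * Real.exp (-I t) := by simp only [hφ]; gcongr
      _ = _ := by ring
  have hφ0 (t : ℝ) : 0 ≤ φ t := by positivity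
  have hexpi (t : ℝ) : IntegrableOn (fun r => P.aBar * Real.exp (-I t) * Real.exp (-P.δ * r))
      (Ioi t) := (exp_neg_integrableOn_Ioi t hδ).const_mul _
  have hφi (t : ℝ) : IntegrableOn φ (Ioi t) := by
    refine (hexpi t).mono' hφc.aestronglyMeasurable
      ((ae_restrict_iff' measurableSet_Ioi).2 (ae_of_all _ fun r hr => ?_))
    rw [Real.norm_of_nonneg (hφ0 r)]
    exact hφle t r (le_of_lt hr)
  -- Variation of constants: the costate is e^{I(t)} ∫_t^∞ φ. Writing the tail as total minus
  -- primitive gives local Lipschitz regularity and the derivative −φ.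
  set S : ℝ → ℝ := fun t => (∫ r in Ioi (0 : ℝ), φ r) - ∫ r in (0 : ℝ)..t, φ r with hS
  have hS' (t : ℝ) : S t = ∫ r in Ioi t, φ r := by
    rw [hS, ← intervalIntegral.integral_interval_add_Ioi (hφi 0) (hφi t)]
    ring
  have hSl : LocallyLipschitz S := (LocallyLipschitz.const _).sub_real
    (locallyLipschitz_integral hφc.measurable hφc.abs fun t => le_rfl)
  refine ⟨fun t => S t * Real.exp (I t), hSl.mul_real (hIl.contDiff_comp (by fun_prop)),
    fun t ht => ⟨?_, ?_⟩, ?_⟩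
  · refine mul_nonneg ?_ (Real.exp_pos _).le
    rw [hS']
    exact integral_nonneg fun r => hφ0 r
  · have h1 : S t ≤ P.aBar * Real.exp (-I t) * (-Real.exp (-P.δ * t) / -P.δ) := by
      rw [hS', ← integral_exp_mul_Ioi (by linarith : -P.δ < 0), ← integral_const_mul]
      exact setIntegral_mono_on (hφi t) (hexpi t) measurableSet_Ioi
        fun r hr => hφle t r (le_of_lt hr)
    calc S t * Real.exp (I t)
        ≤ P.aBar * Real.exp (-I t) * (-Real.exp (-P.δ * t) / -P.δ) * Real.exp (I t) := by gcongr
      _ = P.aBar / P.δ * Real.exp (-P.δ * t) * (Real.exp (-I t) * Real.exp (I t)) := by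
        field_simp
      _ = _ := by rw [← Real.exp_add]; simp
  · filter_upwards [ae_hasDerivAt_integral_zero hm continuous_const hb,
      ae_hasDerivAt_integral_zero hφc.measurable hφc.abs fun t => le_rfl] with t d₁ d₂
    have d₃ : HasDerivAt S (0 - φ t) t := (hasDerivAt_const t _).sub d₂
    have d₄ : HasDerivAt (fun t => Real.exp (I t)) (Real.exp (I t) * P.linRate h γ₀ t) t := d₁.exp
    refine (d₃.mul d₄).congr_deriv ?_
    have : φ t * Real.exp (I t) = P.aBar * Real.exp (-P.δ * t) := by
      simp only [hφ]
      rw [mul_assoc, ← Real.exp_add]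
      simp
    rw [zero_sub, neg_mul, this]
    ring

/-- A function that decays like the discount factor is integrable against bounded functions. -/
lemma integrableOn_costate_mul (hP : P.Regular) {q : ℝ → ℝ} (hq : Continuous q)
    (hqb : ∀ t, 0 ≤ t → 0 ≤ q t ∧ q t ≤ P.aBar / P.δ * Real.exp (-P.δ * t)) {φ : ℝ → ℝ}
    (hm : Measurable φ) {C : ℝ} (hb : ∀ t, |φ t| ≤ C) :
    IntegrableOn (fun t => q t * φ t) (Ioi 0) := by
  have hqi : IntegrableOn q (Ioi 0) := by
    refine ((integrableOn_discount hP).const_mul (P.aBar / P.δ)).mono' hq.aestronglyMeasurable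
      ((ae_restrict_iff' measurableSet_Ioi).2 (ae_of_all _ fun t ht => ?_))
    obtain ⟨h1, h2⟩ := hqb t (le_of_lt ht)
    rwa [Real.norm_of_nonneg h1]
  exact hqi.mul_bdd hm.aestronglyMeasurable (ae_of_all _ hb)

lemma abs_variation_le {h k : ℝ≥0 → ℝ} (hh : h ∈ P.admissible) (hk : k ∈ P.admissible)
    {G : ℝ} (hG : G ∈ Icc 0 P.γmax) (t : ℝ) :
    |(k t.toNNReal - h t.toNNReal) * G ^ 2| ≤ P.hmax * P.γmax ^ 2 := by
  obtain ⟨a1, a2⟩ := hh.2 t.toNNReal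
  obtain ⟨b1, b2⟩ := hk.2 t.toNNReal
  have := hG.1; have h2 := hG.2
  rw [abs_mul, abs_of_nonneg (sq_nonneg G)]
  gcongr
  · linarith
  · exact abs_le.2 ⟨by linarith, by linarith⟩

lemma measurable_variation {h k : ℝ≥0 → ℝ} (hh : h ∈ P.admissible) (hk : k ∈ P.admissible)
    {G : ℝ → ℝ} (hG : Continuous G) :
    Measurable fun t : ℝ => (k t.toNNReal - h t.toNNReal) * G t ^ 2 := by
  have := hh.1; have := hk.1; have := hG.measurable
  fun_prop

/-- The adjoint estimate for the effect of a change of control on the conditional variance. -/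
lemma integral_state_sub_le (hP : P.Regular) {h : ℝ≥0 → ℝ} (hh : h ∈ P.admissible) {γ₀ : ℝ}
    (hγ₀ : γ₀ ∈ Icc 0 P.γmax) {q : ℝ → ℝ} (hq : LocallyLipschitz q)
    (hqb : ∀ t, 0 ≤ t → 0 ≤ q t ∧ q t ≤ P.aBar / P.δ * Real.exp (-P.δ * t))
    (hqd : ∀ᵐ t, HasDerivAt q (-(P.aBar * Real.exp (-P.δ * t)) + P.linRate h γ₀ t * q t) t)
    {k : ℝ≥0 → ℝ} (hk : k ∈ P.admissible) :
    ∫ t in Ioi (0 : ℝ), (Real.exp (-P.δ * t) * (P.aBar * (P.state k γ₀ t - P.state h γ₀ t)) +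
      q t * ((k t.toNNReal - h t.toNNReal) * P.state k γ₀ t ^ 2)) ≤ 0 := by
  have hδ := hP.δ_pos
  have ha := hP.aBar_pos
  have sh := isState_state hP hh hγ₀
  have sk := isState_state hP hk hγ₀
  have mh := state_mem hP hh hγ₀
  have mk := state_mem hP hk hγ₀
  have ch := sh.lip.continuous
  have ck := sk.lip.continuous
  have cq := hq.continuous
  set e : ℝ → ℝ := fun t => P.state k γ₀ t - P.state h γ₀ t with he
  have el : LocallyLipschitz e := sk.lip.sub_real sh.lip
  have eb (t : ℝ) : |e t| ≤ P.γmax :=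
    abs_le.2 ⟨by simp only [he]; linarith [(mh t).2, (mk t).1],
      by simp only [he]; linarith [(mh t).1, (mk t).2]⟩
  set ψ : ℝ → ℝ := fun t => Real.exp (-P.δ * t) * (P.aBar * e t) +
    q t * ((k t.toNNReal - h t.toNNReal) * P.state k γ₀ t ^ 2) with hψ
  have hvm := measurable_variation hh hk ck
  have hψm : Measurable ψ := by
    have h1 : Measurable fun t => Real.exp (-P.δ * t) * (P.aBar * e t) :=
      Continuous.measurable (by have := el.continuous; fun_prop)
    exact h1.add (cq.measurable.mul hvm)
  have hψb (t : ℝ) : |ψ t| ≤ Real.exp (-P.δ * t) * (P.aBar * P.γmax) +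
      |q t| * (P.hmax * P.γmax ^ 2) := by
    refine (abs_add_le _ _).trans ?_
    rw [abs_mul, abs_mul, abs_mul, abs_of_pos (Real.exp_pos _), abs_of_pos ha]
    gcongr
    · exact eb t
    · exact abs_variation_le hh hk (mk t) t
  have hψi : IntegrableOn ψ (Ioi 0) := by
    refine Integrable.add (integrableOn_discount_mul hP (C := P.aBar * P.γmax)
      (by have := el.continuous.measurable; fun_prop) fun t => ?_)
      (integrableOn_costate_mul hP cq hqb hvm fun t => abs_variation_le hh hk (mk t) t)
    rw [abs_mul, abs_of_pos ha]
    gcongr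
    exact eb t
  have hψbc : Continuous fun t => Real.exp (-P.δ * t) * (P.aBar * P.γmax) +
      |q t| * (P.hmax * P.γmax ^ 2) := by fun_prop
  have hfin (T : ℝ) (hT : 0 ≤ T) :
      ∫ t in (0 : ℝ)..T, ψ t ≤ P.aBar / P.δ * P.γmax * Real.exp (-P.δ * T) := by
    -- The function q e + ∫₀ᵗ ψ starts at 0 and is nonincreasing, so ∫₀ᵀ ψ ≤ −q(T)e(T), which is
    -- exponentially small.
    have h1 := ((hq.mul_real el).add_real
      (locallyLipschitz_integral hψm hψbc hψb)).le_of_ae_deriv_nonpos hT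
      (f := fun t => (-(P.aBar * Real.exp (-P.δ * t)) + P.linRate h γ₀ t * q t) * e t +
        q t * (P.f (P.state k γ₀ t) (k t.toNNReal) - P.f (P.state h γ₀ t) (h t.toNNReal)) +
        ψ t) ?_
    · have he0 : e 0 = 0 := by simp only [he, sh.init, sk.init, sub_self]
      simp only [intervalIntegral.integral_same, he0, mul_zero, add_zero] at h1
      obtain ⟨q1, q2⟩ := hqb T hT
      have h2 : -(q T * e T) ≤ P.aBar / P.δ * Real.exp (-P.δ * T) * P.γmax := by
        refine (neg_le_abs _).trans ?_
        rw [abs_mul, abs_of_nonneg q1]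
        exact mul_le_mul q2 (eb T) (abs_nonneg _) (by positivity)
      linarith
    · filter_upwards [hqd, sh.deriv, sk.deriv, ae_hasDerivAt_integral_zero hψm hψbc hψb]
        with t d₁ d₂ d₃ d₄ ht
      refine ⟨(d₁.mul ((d₃ ht.1).sub (d₂ ht.1))).add d₄, ?_⟩
      have hA : 0 ≤ (1 / P.σ₁) ^ 2 + h t.toNNReal := by have := (hh.2 t.toNNReal).1; positivity
      -- The adjoint equation cancels all terms linear in e. What remains is −q(σ₁⁻² + h)e², the
      -- remainder of the concave quadratic drift.
      have h1 := mul_nonneg (hqb t ht.1.le).1 (mul_nonneg hA (sq_nonneg (e t)))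
      refine le_of_eq_of_le ?_ (neg_nonpos.2 h1)
      simp only [hψ, he, linRate, f]
      ring
  refine le_of_tendsto_of_tendsto (intervalIntegral_tendsto_integral_Ioi 0 hψi tendsto_id)
    (b := atTop) (g := fun T => P.aBar / P.δ * P.γmax * Real.exp (-P.δ * T)) ?_ ?_
  · have : Tendsto (fun T : ℝ => Real.exp (-P.δ * T)) atTop (𝓝 0) := by
      refine Real.tendsto_exp_atBot.comp ?_
      exact tendsto_id.const_mul_atTop_of_neg (by linarith)
    simpa using this.const_mul (P.aBar / P.δ * P.γmax)
  · filter_upwards [eventually_ge_atTop 0] with T hT using hfin T hT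

/-- The cost of a control is bounded by a linearization around another control. -/
lemma J_sub_J_le (hP : P.Regular) {h : ℝ≥0 → ℝ} (hh : h ∈ P.admissible) {γ₀ : ℝ}
    (hγ₀ : γ₀ ∈ Icc 0 P.γmax) {q : ℝ → ℝ} (hq : LocallyLipschitz q)
    (hqb : ∀ t, 0 ≤ t → 0 ≤ q t ∧ q t ≤ P.aBar / P.δ * Real.exp (-P.δ * t))
    (hqd : ∀ᵐ t, HasDerivAt q (-(P.aBar * Real.exp (-P.δ * t)) + P.linRate h γ₀ t * q t) t)
    {k : ℝ≥0 → ℝ} (hk : k ∈ P.admissible) :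
    P.J k γ₀ - P.J h γ₀ ≤ ∫ t in Ioi (0 : ℝ),
      (Real.exp (-P.δ * t) * (P.c (k t.toNNReal) - P.c (h t.toNNReal)) -
        q t * ((k t.toNNReal - h t.toNNReal) * P.state k γ₀ t ^ 2)) := by
  have hle := integral_state_sub_le hP hh hγ₀ hq hqb hqd hk
  have mh := state_mem hP hh hγ₀
  have mk := state_mem hP hk hγ₀
  have ch := continuous_state hP hh hγ₀
  have ck := continuous_state hP hk hγ₀
  obtain ⟨C, hC⟩ := exists_cost_bound hP
  have i1 : IntegrableOn (fun t : ℝ => Real.exp (-P.δ * t) *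
      (P.aBar * (P.state k γ₀ t - P.state h γ₀ t))) (Ioi 0) :=
    integrableOn_discount_mul hP (C := P.aBar * P.γmax)
      (Continuous.measurable (by fun_prop)) fun t => by
        rw [abs_mul, abs_of_pos hP.aBar_pos]
        have := hP.aBar_pos
        gcongr
        exact abs_le.2 ⟨by linarith [(mh t).2, (mk t).1], by linarith [(mh t).1, (mk t).2]⟩
  have i2 := integrableOn_costate_mul hP hq.continuous hqb (measurable_variation hh hk ck)
    fun t => abs_variation_le hh hk (mk t) t
  have i3 : IntegrableOn (fun t : ℝ => Real.exp (-P.δ * t) *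
      (P.c (k t.toNNReal) - P.c (h t.toNNReal))) (Ioi 0) :=
    integrableOn_discount_mul hP (C := C + C)
      ((measurable_cost hP hk).sub (measurable_cost hP hh)) fun t =>
        (abs_sub _ _).trans (add_le_add (hC _ (hk.2 _)) (hC _ (hh.2 _)))
  rw [J_eq, J_eq, ← integral_sub (integrableOn_running hP hk hγ₀) (integrableOn_running hP hh hγ₀)]
  rw [integral_add i1 i2] at hle
  rw [integral_sub i3 i2]
  have : ∫ t in Ioi (0 : ℝ), (Real.exp (-P.δ * t) * (P.aBar * P.state k γ₀ t + P.c (k t.toNNReal)) -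
      Real.exp (-P.δ * t) * (P.aBar * P.state h γ₀ t + P.c (h t.toNNReal))) =
      (∫ t in Ioi (0 : ℝ), Real.exp (-P.δ * t) *
        (P.aBar * (P.state k γ₀ t - P.state h γ₀ t))) +
      ∫ t in Ioi (0 : ℝ), Real.exp (-P.δ * t) * (P.c (k t.toNNReal) - P.c (h t.toNNReal)) := by
    rw [← integral_add i1 i3]
    refine integral_congr_ae (ae_of_all _ fun t => ?_)
    simp only
    ring
  rw [this]
  linarith

end Costate

end InfoModel

/-! ### First order condition; the continuous optimal control -/

namespace InfoModel

open MeasureTheory Set Filter Topology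

variable {P : InfoModel}

section Optimality

/-- The first order condition at an optimal control. -/
lemma IsOptimal.variational (hP : P.Regular) {h : ℝ≥0 → ℝ} {γ₀ : ℝ} (hopt : P.IsOptimal h γ₀)
    (hγ₀ : γ₀ ∈ Icc 0 P.γmax) {q : ℝ → ℝ} (hq : LocallyLipschitz q)
    (hqb : ∀ t, 0 ≤ t → 0 ≤ q t ∧ q t ≤ P.aBar / P.δ * Real.exp (-P.δ * t))
    (hqd : ∀ᵐ t, HasDerivAt q (-(P.aBar * Real.exp (-P.δ * t)) + P.linRate h γ₀ t * q t) t)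
    {k : ℝ≥0 → ℝ} (hk : k ∈ P.admissible) :
    0 ≤ ∫ t in Ioi (0 : ℝ),
      (Real.exp (-P.δ * t) * (P.c (k t.toNNReal) - P.c (h t.toNNReal)) -
        q t * ((k t.toNNReal - h t.toNNReal) * P.state h γ₀ t ^ 2)) := by
  have hh := hopt.1
  obtain ⟨C, hC⟩ := exists_cost_bound hP
  let ε (n : ℕ) : ℝ := 1 / ((n : ℝ) + 1)
  have hε0 (n : ℕ) : 0 < ε n := by positivity
  have hε1 (n : ℕ) : ε n ≤ 1 := by
    rw [div_le_one (by positivity)]; linarith [(Nat.cast_nonneg n : (0 : ℝ) ≤ n)]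
  have hεlim : Tendsto ε atTop (𝓝 0) := tendsto_one_div_add_atTop_nhds_zero_nat
  -- Perturbation from h towards k. Convexity of `c` bounds the cost increment by ε ∫ F; dividing by
  -- ε and letting ε → 0 turns the state of the perturbation into that of h.
  let κ (n : ℕ) : ℝ≥0 → ℝ := fun t => (1 - ε n) * h t + ε n * k t
  have hκ (n : ℕ) : κ n ∈ P.admissible :=
    combine_mem_admissible hh hk (by linarith [hε1 n]) (hε0 n).le (by ring)
  have cκ (n : ℕ) := continuous_state hP (hκ n) hγ₀
  have mκ (n : ℕ) := state_mem hP (hκ n) hγ₀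
  have i3 (k : ℝ≥0 → ℝ) (hk : k ∈ P.admissible) : IntegrableOn (fun t : ℝ =>
      Real.exp (-P.δ * t) * (P.c (k t.toNNReal) - P.c (h t.toNNReal))) (Ioi 0) :=
    integrableOn_discount_mul hP (C := C + C)
      ((measurable_cost hP hk).sub (measurable_cost hP hh)) fun t =>
        (abs_sub _ _).trans (add_le_add (hC _ (hk.2 _)) (hC _ (hh.2 _)))
  have i2 (k : ℝ≥0 → ℝ) (hk : k ∈ P.admissible) (n : ℕ) :=
    integrableOn_costate_mul hP hq.continuous hqb (measurable_variation hh hk (cκ n))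
    fun t => abs_variation_le hh hk (mκ n t) t
  set F : ℕ → ℝ → ℝ := fun n t =>
    Real.exp (-P.δ * t) * (P.c (k t.toNNReal) - P.c (h t.toNNReal)) -
      q t * ((k t.toNNReal - h t.toNNReal) * P.state (κ n) γ₀ t ^ 2) with hF
  have hFi (n : ℕ) : IntegrableOn (F n) (Ioi 0) := (i3 k hk).sub (i2 k hk n)
  have hFn (n : ℕ) : 0 ≤ ∫ t in Ioi (0 : ℝ), F n t := by
    have h1 := J_sub_J_le hP hh hγ₀ hq hqb hqd (hκ n)
    have h2 := v_le hP (hκ n) hγ₀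
    rw [← hopt.2] at h2
    have h3 : ∫ t in Ioi (0 : ℝ),
        (Real.exp (-P.δ * t) * (P.c (κ n t.toNNReal) - P.c (h t.toNNReal)) -
          q t * ((κ n t.toNNReal - h t.toNNReal) * P.state (κ n) γ₀ t ^ 2)) ≤
        ∫ t in Ioi (0 : ℝ), ε n * F n t := by
      refine setIntegral_mono_on ((i3 _ (hκ n)).sub (i2 _ (hκ n) n)) ((hFi n).const_mul _)
        measurableSet_Ioi fun t _ => ?_
      have hc := hP.c_convex.convexOn.2 (hh.2 t.toNNReal) (hk.2 t.toNNReal)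
        (by linarith [hε1 n] : 0 ≤ 1 - ε n) (hε0 n).le (by ring)
      simp only [smul_eq_mul] at hc
      have hc' := mul_le_mul_of_nonneg_left hc (Real.exp_pos (-P.δ * t)).le
      simp only [hF, κ]
      linarith
    rw [integral_const_mul] at h3
    by_contra! hneg
    have := mul_neg_of_pos_of_neg (hε0 n) hneg
    linarith
  have hlim : Tendsto (fun n => ∫ t in Ioi (0 : ℝ), F n t) atTop (𝓝 (∫ t in Ioi (0 : ℝ),
      (Real.exp (-P.δ * t) * (P.c (k t.toNNReal) - P.c (h t.toNNReal)) -
        q t * ((k t.toNNReal - h t.toNNReal) * P.state h γ₀ t ^ 2)))) := by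
    refine tendsto_integral_of_dominated_convergence (fun t => Real.exp (-P.δ * t) * (C + C) +
      P.aBar / P.δ * Real.exp (-P.δ * t) * (P.hmax * P.γmax ^ 2))
      (fun n => (hFi n).aestronglyMeasurable)
      (((integrableOn_discount hP).mul_const _).add
        (((integrableOn_discount hP).const_mul _).mul_const _)) (fun n => ?_) ?_
    · refine (ae_restrict_iff' measurableSet_Ioi).2 (ae_of_all _ fun t ht => ?_)
      obtain ⟨q1, q2⟩ := hqb t (le_of_lt ht)
      refine (norm_sub_le _ _).trans (add_le_add ?_ ?_)
      · rw [norm_mul, Real.norm_of_nonneg (Real.exp_pos _).le]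
        gcongr
        exact (abs_sub _ _).trans (add_le_add (hC _ (hk.2 _)) (hC _ (hh.2 _)))
      · rw [norm_mul, Real.norm_of_nonneg q1]
        exact mul_le_mul q2 (abs_variation_le hh hk (mκ n t) t) (norm_nonneg _)
          (q1.trans q2)
    · refine (ae_restrict_iff' measurableSet_Ioi).2 (ae_of_all _ fun t ht => ?_)
      have hs := tendsto_state_of_ae_tendsto hP hγ₀ hκ hh (ae_of_all _ fun s _ => by
        have := ((hεlim.const_sub 1).mul_const (h s.toNNReal)).add
          (hεlim.mul_const (k s.toNNReal))
        simpa using this) ht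
      exact (((hs.pow 2).const_mul _).const_mul _).const_sub _
  exact ge_of_tendsto' hlim hFn

/-- Existence of a continuous optimal control. -/
lemma exists_continuous_isOptimal (hP : P.Regular) {γ₀ : ℝ} (hγ₀ : γ₀ ∈ Ioc 0 P.γmax) :
    ∃ k, Continuous k ∧ P.IsOptimal k γ₀ := by
  have hγ := Ioc_subset_Icc_self hγ₀
  obtain ⟨h, hopt⟩ := exists_isOptimal hP hγ₀
  have hh := hopt.1
  obtain ⟨q, hq, hqb, hqd⟩ := exists_costate hP hh hγ
  obtain ⟨m, hmc, hm, hmin, huniq⟩ :=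
    hP.c_convex.exists_continuous_argmin hP.hmax_nonneg hP.c_cont
  -- The undiscounted marginal benefit of information: the first order integrand becomes a
  -- discounted difference of η ↦ c(η) − Qη at k and at h.
  let Q : ℝ → ℝ := fun t => Real.exp (P.δ * t) * q t * P.state h γ₀ t ^ 2
  have hQ : Continuous Q := by
    have := hq.continuous; have := continuous_state hP hh hγ; fun_prop
  let k : ℝ≥0 → ℝ := fun t => m (Q t)
  have hkc : Continuous k := by fun_prop
  have hk : k ∈ P.admissible := ⟨hkc.measurable, fun t => hm _⟩
  have hid (t : ℝ) (ht : 0 < t) :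
      Real.exp (-P.δ * t) * (P.c (k t.toNNReal) - P.c (h t.toNNReal)) -
        q t * ((k t.toNNReal - h t.toNNReal) * P.state h γ₀ t ^ 2) =
      Real.exp (-P.δ * t) * ((P.c (m (Q t)) - Q t * m (Q t)) -
        (P.c (h t.toNNReal) - Q t * h t.toNNReal)) := by
    have h1 : Real.exp (-P.δ * t) * Q t = q t * P.state h γ₀ t ^ 2 := by
      simp only [Q]
      rw [← mul_assoc, ← mul_assoc, ← Real.exp_add]
      simp
    simp only [k, Real.coe_toNNReal t ht.le]
    linear_combination (m (Q t) - h t.toNNReal) * h1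
  have hvar := hopt.variational hP hγ hq hqb hqd hk
  have hae : ∀ᵐ t : ℝ, 0 < t → k t.toNNReal = h t.toNNReal := by
    rw [setIntegral_congr_fun measurableSet_Ioi fun t ht => hid t ht] at hvar
    obtain ⟨C, hC⟩ := exists_cost_bound hP
    have hInt : IntegrableOn (fun t => Real.exp (-P.δ * t) * ((P.c (m (Q t)) - Q t * m (Q t)) -
        (P.c (h t.toNNReal) - Q t * h t.toNNReal))) (Ioi 0) := by
      refine IntegrableOn.congr_fun ?_ (fun t ht => hid t ht) measurableSet_Ioi
      refine Integrable.sub (integrableOn_discount_mul hP (C := C + C)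
        ((measurable_cost hP hk).sub (measurable_cost hP hh)) fun t =>
          (abs_sub _ _).trans (add_le_add (hC _ (hk.2 _)) (hC _ (hh.2 _))))
        (integrableOn_costate_mul hP hq.continuous hqb
          (measurable_variation hh hk (continuous_state hP hh hγ))
          fun t => abs_variation_le hh hk (state_mem hP hh hγ t) t)
    -- Pointwise minimality of `m (Q t)` makes the integrand nonpositive while its integral is
    -- nonnegative; hence it vanishes almost everywhere and h is the minimizer.
    have hnn : ∀ t, 0 ≤ -(Real.exp (-P.δ * t) * ((P.c (m (Q t)) - Q t * m (Q t)) -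
        (P.c (h t.toNNReal) - Q t * h t.toNNReal))) := fun t => by
      have := mul_nonneg (Real.exp_pos (-P.δ * t)).le (sub_nonneg.2 (hmin (Q t) _ (hh.2 t.toNNReal)))
      linarith
    have hz := (setIntegral_eq_zero_iff_of_nonneg_ae (μ := volume) (s := Ioi (0 : ℝ))
      (ae_of_all _ hnn) hInt.neg).1 (by
        have h1 := integral_nonneg_of_ae (μ := volume.restrict (Ioi (0 : ℝ))) (ae_of_all _ hnn)
        refine le_antisymm ?_ h1
        rw [integral_neg]
        linarith)
    filter_upwards [(ae_restrict_iff' measurableSet_Ioi).1 hz] with t ht ht0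
    have h1 := ht ht0
    simp only [Pi.zero_apply, neg_eq_zero, mul_eq_zero, (Real.exp_pos _).ne', false_or] at h1
    have := huniq (Q t) _ (hh.2 t.toNNReal) (by linarith)
    simp only [k, Real.coe_toNNReal t (le_of_lt ht0), this]
  refine ⟨k, hkc, hk, le_antisymm ?_ (v_le hP hk hγ)⟩
  -- The linearized bound vanishes for k = h almost everywhere, so passing to the continuous version
  -- does not raise the cost.
  have hle := J_sub_J_le hP hh hγ hq hqb hqd hk
  rw [integral_eq_zero_of_ae ((ae_restrict_iff' measurableSet_Ioi).2 (by
    filter_upwards [hae] with t ht ht0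
    simp [ht ht0]))] at hle
  rw [← hopt.2]
  linarith

/-- Continuous optimal controls are unique. -/
lemma IsOptimal.eq_of_continuous (hP : P.Regular) {γ₀ : ℝ} (hγ₀ : γ₀ ∈ Ioc 0 P.γmax)
    {h k : ℝ≥0 → ℝ} (hh : P.IsOptimal h γ₀) (hk : P.IsOptimal k γ₀) (hhc : Continuous h)
    (hkc : Continuous k) : h = k := by
  have hnn : ∀ t : ℝ, 0 ≤ Real.exp (-P.δ * t) * |h t.toNNReal - k t.toNNReal| :=
    fun t => by positivity
  have hzero : ∫ t in Ioi (0 : ℝ), Real.exp (-P.δ * t) * |h t.toNNReal - k t.toNNReal| = 0 := by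
    refine le_antisymm (le_of_forall_pos_le_add fun ε hε => ?_) (integral_nonneg hnn)
    obtain ⟨η, hη, hclose⟩ := exists_near_optimal_close hP hγ₀ hε
    rw [zero_add]
    exact (hclose h hh.1 k hk.1 (by linarith [hh.2]) (by linarith [hk.2])).le
  rw [setIntegral_eq_zero_iff_of_nonneg_ae (ae_of_all _ hnn)
    (integrableOn_discount_abs_sub hP hh.1 hk.1)] at hzero
  have hcont : Continuous fun t : ℝ => Real.exp (-P.δ * t) * |h t.toNNReal - k t.toNNReal| := by
    fun_prop
  have heq : EqOn (fun t : ℝ => Real.exp (-P.δ * t) * |h t.toNNReal - k t.toNNReal|) 0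
      (closure (Ioi 0)) :=
    (Measure.eqOn_open_of_ae_eq hzero isOpen_Ioi hcont.continuousOn continuousOn_const).closure
      hcont continuous_const
  ext t
  have := heq (x := (t : ℝ)) (by rw [closure_Ioi]; exact t.2)
  simpa [sub_eq_zero] using this

end Optimality

end InfoModel

/-! ### Convexity, semiconcavity and regularity of the value function -/

namespace InfoModel

open MeasureTheory Set Filter Topology

variable {P : InfoModel}

section ValueFunction

lemma inv_mem_Ioc (hP : P.Regular) {x : ℝ} (hx : x ∈ Ici (1 / P.γmax)) :
    0 < x ∧ x⁻¹ ∈ Ioc 0 P.γmax := by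
  have h0 : 0 < P.γmax⁻¹ := inv_pos.2 hP.γmax_pos
  have h1 : P.γmax⁻¹ ≤ x := by simpa using hx
  exact ⟨h0.trans_le h1, inv_pos.2 (h0.trans_le h1), by simpa using inv_anti₀ h0 h1⟩

lemma integrableOn_discount_state (hP : P.Regular) {h : ℝ≥0 → ℝ} (hh : h ∈ P.admissible) {γ₀ : ℝ}
    (hγ₀ : γ₀ ∈ Icc 0 P.γmax) :
    IntegrableOn (fun t : ℝ => Real.exp (-P.δ * t) * P.state h γ₀ t) (Ioi 0) :=
  integrableOn_discount_mul hP (continuous_state hP hh hγ₀).measurable (C := P.γmax) fun t => by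
    obtain ⟨h1, h2⟩ := state_mem hP hh hγ₀ t
    rwa [abs_of_nonneg h1]

/-- Strict convexity of the value function in the precision. -/
lemma strictConvexOn_v_inv (hP : P.Regular) :
    StrictConvexOn ℝ (Ici (1 / P.γmax)) fun x => P.v x⁻¹ := by
  refine ⟨convex_Ici _, fun x hx y hy hxy α β hα hβ hαβ => ?_⟩
  obtain ⟨hx0, hγ₁⟩ := inv_mem_Ioc hP hx
  obtain ⟨hy0, hγ₂⟩ := inv_mem_Ioc hP hy
  simp only [smul_eq_mul]
  obtain ⟨h₁, hh₁, hv₁⟩ := exists_isOptimal hP hγ₁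
  obtain ⟨h₂, hh₂, hv₂⟩ := exists_isOptimal hP hγ₂
  have hm := harmonic_mem hP hγ₁ hγ₂ hα.le hβ.le hαβ
  have hh := combine_mem_admissible hh₁ hh₂ hα.le hβ.le hαβ
  have hst (t : ℝ) (ht : 0 < t) := state_harmonic_le_combination hP hh₁ hh₂ hγ₁ hγ₂ hα.le hβ.le
    hαβ ht.le
  have hmlt := harmonic_mean_lt hγ₁.1 hγ₂.1 (by simpa using hxy) hα hβ hαβ
  rw [inv_inv, inv_inv] at hm hst hmlt
  set h : ℝ≥0 → ℝ := fun t => α * h₁ t + β * h₂ t with hdef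
  have g₁ := Ioc_subset_Icc_self hγ₁
  have g₂ := Ioc_subset_Icc_self hγ₂
  have g := Ioc_subset_Icc_self hm
  set D : ℝ → ℝ := fun t => Real.exp (-P.δ * t) * (P.aBar * (α * P.state h₁ x⁻¹ t +
    β * P.state h₂ y⁻¹ t - P.state h (α * x + β * y)⁻¹ t)) with hD
  have hDi : IntegrableOn D (Ioi 0) := by
    have := ((((integrableOn_discount_state hP hh₁ g₁).const_mul α).add
      ((integrableOn_discount_state hP hh₂ g₂).const_mul β)).sub
      (integrableOn_discount_state hP hh g)).const_mul P.aBar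
    refine IntegrableOn.congr_fun this (fun t _ => ?_) measurableSet_Ioi
    simp only [hD, Pi.add_apply, Pi.sub_apply]
    ring
  -- Strictness arises here: at time 0 the gap is that between the arithmetic and harmonic means of
  -- distinct variances, and continuity gives it positive mass.
  have hDpos : 0 < ∫ t in Ioi (0 : ℝ), D t := by
    refine integral_Ioi_pos_of_continuous ?_ hDi (fun t ht => ?_) ?_
    · have := continuous_state hP hh₁ g₁
      have := continuous_state hP hh₂ g₂
      have := continuous_state hP hh g
      fun_prop
    · exact mul_nonneg (Real.exp_pos _).le
        (mul_nonneg hP.aBar_pos.le (sub_nonneg.2 (hst t ht)))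
    · simp only [hD, state_zero hP hh₁ g₁, state_zero hP hh₂ g₂, state_zero hP hh g]
      exact mul_pos (Real.exp_pos _) (mul_pos hP.aBar_pos (sub_pos.2 hmlt))
  have hle := setIntegral_le_combination hDi (integrableOn_running hP hh₁ g₁)
    (integrableOn_running hP hh₂ g₂) (integrableOn_running hP hh g)
    (integrableOn_discount hP) α β (-1) 0 (fun t _ => by
      have hc := hP.c_convex.convexOn.2 (hh₁.2 t.toNNReal) (hh₂.2 t.toNNReal) hα.le hβ.le hαβ
      simp only [smul_eq_mul] at hc
      have hc' := mul_le_mul_of_nonneg_left hc (Real.exp_pos (-P.δ * t)).le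
      simp only [hD]
      rw [show h t.toNNReal = α * h₁ t.toNNReal + β * h₂ t.toNNReal from rfl]
      linarith)
  rw [← J_eq, ← J_eq, ← J_eq, hv₁, hv₂] at hle
  have := v_le hP hh g
  linarith

/-- The optimal control for γ₀ is used from 0 as well: the state stays below, strictly so near time
0. -/
lemma v_zero_lt (hP : P.Regular) {γ₀ : ℝ} (hγ₀ : γ₀ ∈ Ioc 0 P.γmax) : P.v 0 < P.v γ₀ := by
  obtain ⟨h, hh, hv⟩ := exists_isOptimal hP hγ₀
  have g := Ioc_subset_Icc_self hγ₀
  have g0 : (0 : ℝ) ∈ Icc 0 P.γmax := ⟨le_rfl, hP.γmax_pos.le⟩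
  set D : ℝ → ℝ := fun t => Real.exp (-P.δ * t) * (P.aBar * (P.state h γ₀ t - P.state h 0 t))
    with hD
  have hDi : IntegrableOn D (Ioi 0) := by
    have := ((integrableOn_discount_state hP hh g).sub
      (integrableOn_discount_state hP hh g0)).const_mul P.aBar
    refine IntegrableOn.congr_fun this (fun t _ => ?_) measurableSet_Ioi
    simp only [hD, Pi.sub_apply]
    ring
  have hDpos : 0 < ∫ t in Ioi (0 : ℝ), D t := by
    refine integral_Ioi_pos_of_continuous ?_ hDi (fun t ht => ?_) ?_
    · have := continuous_state hP hh g
      have := continuous_state hP hh g0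
      fun_prop
    · exact mul_nonneg (Real.exp_pos _).le
        (mul_nonneg hP.aBar_pos.le (sub_nonneg.2 (state_mono hP hh g0 g hγ₀.1.le ht.le)))
    · simp only [hD, state_zero hP hh g, state_zero hP hh g0, sub_zero]
      exact mul_pos (Real.exp_pos _) (mul_pos hP.aBar_pos hγ₀.1)
  have hle := setIntegral_le_combination hDi (integrableOn_running hP hh g)
    (integrableOn_running hP hh g0) (integrableOn_discount hP) (integrableOn_discount hP)
    1 (-1) 0 0 (fun t _ => le_of_eq (by simp only [hD]; ring))
  rw [← J_eq, ← J_eq, hv] at hle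
  have := v_le hP hh g0
  linarith

/-- Semiconcavity of the value function in the precision. -/
lemma concaveOn_v_inv_sub_sq (hP : P.Regular) :
    ConcaveOn ℝ (Ici (1 / P.γmax)) fun x =>
      P.v x⁻¹ - P.aBar * P.γmax ^ 3 / P.δ * x ^ 2 := by
  refine ⟨convex_Ici _, fun x hx y hy α β hα hβ hαβ => ?_⟩
  have hz := convex_Ici (1 / P.γmax) hx hy hα hβ hαβ
  simp only [smul_eq_mul] at hz ⊢
  obtain ⟨hx0, hγ₁⟩ := inv_mem_Ioc hP hx
  obtain ⟨hy0, hγ₂⟩ := inv_mem_Ioc hP hy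
  obtain ⟨hz0, hγ⟩ := inv_mem_Ioc hP hz
  set z := α * x + β * y with hzdef
  obtain ⟨h, hh, hv⟩ := exists_isOptimal hP hγ
  have g₁ := Ioc_subset_Icc_self hγ₁
  have g₂ := Ioc_subset_Icc_self hγ₂
  have g := Ioc_subset_Icc_self hγ
  set C := P.γmax ^ 3 * (α * β * (x - y) ^ 2) with hC
  have hC0 : 0 ≤ C := by have := hP.γmax_pos; positivity
  -- The defect equals αβ(x − y)²/(xyz), and each reciprocal is at most γmax. Comparison then
  -- preserves the bound C for all times.
  have hinit : α * x⁻¹ + β * y⁻¹ - z⁻¹ ≤ C := by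
    have e1 : α * x⁻¹ + β * y⁻¹ - z⁻¹ = x⁻¹ * y⁻¹ * z⁻¹ * (α * β * (x - y) ^ 2) := by
      obtain rfl : β = 1 - α := by linarith
      field_simp
      rw [hzdef]
      ring
    rw [e1, hC]
    have e2 : x⁻¹ * y⁻¹ * z⁻¹ ≤ P.γmax * P.γmax * P.γmax := by
      have := hγ₁.1; have := hγ₂.1; have := hγ.1; have := hP.γmax_pos
      gcongr
      · exact hγ₁.2
      · exact hγ₂.2
      · exact hγ.2
    calc _ ≤ P.γmax * P.γmax * P.γmax * (α * β * (x - y) ^ 2) := by gcongr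
      _ = _ := by ring
  have hst (t : ℝ) (ht : 0 < t) :=
    combination_state_sub_le hP hh g g₁ g₂ hα hβ hαβ hC0 hinit ht.le
  have hle := setIntegral_le_combination (φ := fun _ => 0) integrableOn_zero
    (integrableOn_running hP hh g₁)
    (integrableOn_running hP hh g₂) (integrableOn_running hP hh g)
    (integrableOn_discount hP) (-α) (-β) 1 (P.aBar * C) (fun t ht => by
      have h1 := mul_le_mul_of_nonneg_left (hst t ht) hP.aBar_pos.le
      have h2 := mul_le_mul_of_nonneg_left h1 (Real.exp_pos (-P.δ * t)).le
      obtain rfl : β = 1 - α := by linarith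
      linarith)
  rw [← J_eq, ← J_eq, ← J_eq, hv, integral_discount hP, integral_zero] at hle
  have v₁ := mul_le_mul_of_nonneg_left (v_le hP hh g₁) hα
  have v₂ := mul_le_mul_of_nonneg_left (v_le hP hh g₂) hβ
  -- Uses αx² + βy² − z² = αβ(x − y)², so the error is exactly the one absorbed by the quadratic.
  have hfin : P.aBar * C * (1 / P.δ) = P.aBar * P.γmax ^ 3 / P.δ *
      (α * x ^ 2 + β * y ^ 2 - z ^ 2) := by
    obtain rfl : β = 1 - α := by linarith
    rw [hC, hzdef]
    ring
  linarith

/-- Inversion is an involution on [0, ∞] including the endpoints, so infinite precision needs no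
separate treatment. -/
lemma JCheck_eq (hP : P.Regular) {x : ℝ≥0∞} (hx : x⁻¹.toReal ∈ Icc 0 P.γmax) {h : ℝ≥0 → ℝ}
    (hh : h ∈ P.admissible) : P.JCheck h x = P.J h x⁻¹.toReal := by
  unfold JCheck J kCheck condPrec
  refine integral_congr_ae (ae_of_all _ fun t => ?_)
  simp only
  rw [inv_inv, ENNReal.toReal_ofReal (condVar_mem hP hh hx _).1]

lemma vCheck_eq (hP : P.Regular) {x : ℝ≥0∞} (hx : x⁻¹.toReal ∈ Icc 0 P.γmax) :
    P.vCheck x = P.v x⁻¹.toReal := by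
  unfold vCheck v
  exact iInf_congr fun h => JCheck_eq hP hx h.2

lemma vCheckReal_eq (hP : P.Regular) {x : ℝ} (hx : x ∈ Ici (1 / P.γmax)) :
    P.vCheckReal x = P.v x⁻¹ := by
  obtain ⟨hx0, hm⟩ := inv_mem_Ioc hP hx
  have e : (ENNReal.ofReal x)⁻¹.toReal = x⁻¹ := by
    rw [ENNReal.toReal_inv, ENNReal.toReal_ofReal hx0.le]
  unfold vCheckReal
  rw [vCheck_eq hP (by rw [e]; exact Ioc_subset_Icc_self hm), e]

lemma strictConvexOn_vCheckReal (hP : P.Regular) :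
    StrictConvexOn ℝ (Ici (1 / P.γmax)) P.vCheckReal :=
  (strictConvexOn_v_inv hP).congr fun _ hx => (vCheckReal_eq hP hx).symm

lemma concaveOn_vCheckReal_sub_sq (hP : P.Regular) :
    ConcaveOn ℝ (Ici (1 / P.γmax)) fun x =>
      P.vCheckReal x - P.aBar * P.γmax ^ 3 / P.δ * x ^ 2 :=
  (concaveOn_v_inv_sub_sq hP).congr fun x hx => by simp only [vCheckReal_eq hP hx]

lemma vCheck_top_lt (hP : P.Regular) {x : ℝ} (hx : x ∈ Ici (1 / P.γmax)) :
    P.vCheck ∞ < P.vCheckReal x := by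
  rw [vCheck_eq hP (by simp [hP.γmax_pos.le]), vCheckReal_eq hP hx]
  simpa using v_zero_lt hP (inv_mem_Ioc hP hx).2

/-- With one endpoint ∞ the combination is ∞, and the inequality reduces to `vCheck_top_lt`;
otherwise it is the real statement. -/
lemma strictConvexOn_vCheck (hP : P.Regular) :
    StrictConvexOn ℝ≥0 (Ici (ENNReal.ofReal P.γmax)⁻¹) P.vCheck := by
  have hfin {x : ℝ≥0∞} (hx : x ∈ Ici (ENNReal.ofReal P.γmax)⁻¹) (hx' : x ≠ ∞) :
      x.toReal ∈ Ici (1 / P.γmax) ∧ P.vCheck x = P.vCheckReal x.toReal := by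
    refine ⟨?_, by rw [vCheckReal, ENNReal.ofReal_toReal hx']⟩
    have := ENNReal.toReal_mono hx' (mem_Ici.1 hx)
    rwa [ENNReal.toReal_inv, ENNReal.toReal_ofReal hP.γmax_pos.le, ← one_div] at this
  refine ⟨?_, ?_⟩
  · intro x hx y hy a b _ _ hab
    calc (ENNReal.ofReal P.γmax)⁻¹
        = a • (ENNReal.ofReal P.γmax)⁻¹ + b • (ENNReal.ofReal P.γmax)⁻¹ := by
          rw [← add_smul, hab, one_smul]
      _ ≤ a • x + b • y := by gcongr <;> assumption
  · intro x hx y hy hxy a b ha hb hab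
    have hab' : (a : ℝ) + b = 1 := by exact_mod_cast hab
    have ha' : (0 : ℝ) < a := by exact_mod_cast ha
    have hb' : (0 : ℝ) < b := by exact_mod_cast hb
    simp only [NNReal.smul_def, smul_eq_mul]
    simp only [ENNReal.smul_def, smul_eq_mul]
    by_cases hxt : x = ∞
    · subst hxt
      have hyt : y ≠ ∞ := hxy.symm
      obtain ⟨h1, h2⟩ := hfin hy hyt
      rw [ENNReal.mul_top (by exact_mod_cast ha.ne'), top_add, h2]
      have := mul_lt_mul_of_pos_left (vCheck_top_lt hP h1) hb'
      have e : P.vCheck ∞ = a * P.vCheck ∞ + b * P.vCheck ∞ := by rw [← add_mul, hab', one_mul]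
      linarith
    by_cases hyt : y = ∞
    · subst hyt
      obtain ⟨h1, h2⟩ := hfin hx hxt
      rw [ENNReal.mul_top (by exact_mod_cast hb.ne'), add_top, h2]
      have := mul_lt_mul_of_pos_left (vCheck_top_lt hP h1) ha'
      have e : P.vCheck ∞ = a * P.vCheck ∞ + b * P.vCheck ∞ := by rw [← add_mul, hab', one_mul]
      linarith
    · obtain ⟨h1, h2⟩ := hfin hx hxt
      obtain ⟨h3, h4⟩ := hfin hy hyt
      have hne : x.toReal ≠ y.toReal := fun h => hxy ((ENNReal.toReal_eq_toReal_iff' hxt hyt).1 h)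
      have := (strictConvexOn_vCheckReal hP).2 h1 h3 hne ha' hb' hab'
      simp only [smul_eq_mul] at this
      rw [h2, h4]
      refine lt_of_eq_of_lt ?_ this
      rw [vCheckReal]
      congr 1
      rw [ENNReal.ofReal_add (by positivity) (by positivity), ENNReal.ofReal_mul ha'.le,
        ENNReal.ofReal_mul hb'.le, ENNReal.ofReal_toReal hxt, ENNReal.ofReal_toReal hyt,
        ENNReal.ofReal_coe_nnreal, ENNReal.ofReal_coe_nnreal]

lemma semiconcaveLinearOn_vCheckReal (hP : P.Regular) :
    SemiconcaveLinearOn (Ici (1 / P.γmax)) P.vCheckReal := by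
  have := hP.aBar_pos; have := hP.γmax_pos; have := hP.δ_pos
  refine ⟨2 * (P.aBar * P.γmax ^ 3 / P.δ), by positivity, fun x y hx hy => ?_⟩
  have h := (concaveOn_vCheckReal_sub_sq hP).2 hx hy (by norm_num : (0 : ℝ) ≤ 1 / 2)
    (by norm_num : (0 : ℝ) ≤ 1 / 2) (by norm_num)
  simp only [smul_eq_mul] at h
  rw [show 1 / 2 * (x - y) + 1 / 2 * (x + y) = x by ring] at h
  rw [sq_abs]
  linarith

lemma contDiffOn_vCheckReal (hP : P.Regular) :
    ContDiffOn ℝ 1 P.vCheckReal (Ioi (1 / P.γmax)) ∧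
      ∃ K : ℝ≥0, LipschitzOnWith K (deriv P.vCheckReal) (Ioi (1 / P.γmax)) := by
  have := hP.aBar_pos; have := hP.γmax_pos; have := hP.δ_pos
  obtain ⟨h1, h2⟩ := (strictConvexOn_vCheckReal hP).convexOn.contDiffOn_of_semiconcave
    (by positivity) (concaveOn_vCheckReal_sub_sq hP)
  exact ⟨h1, _, h2⟩

lemma contDiffOn_v (hP : P.Regular) : ContDiffOn ℝ 1 P.v (Ioo 0 P.γmax) := by
  have hmaps : MapsTo (fun γ : ℝ => γ⁻¹) (Ioo 0 P.γmax) (Ioi (1 / P.γmax)) := fun γ hγ => by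
    rw [one_div]
    exact (inv_lt_inv₀ hP.γmax_pos hγ.1).2 hγ.2
  have hinv : ContDiffOn ℝ 1 (fun γ : ℝ => γ⁻¹) (Ioo 0 P.γmax) :=
    contDiffOn_id.inv fun γ hγ => hγ.1.ne'
  refine ((contDiffOn_vCheckReal hP).1.comp hinv hmaps).congr fun γ hγ => ?_
  rw [Function.comp_apply, vCheckReal_eq hP (Ioi_subset_Ici_self (hmaps hγ)), inv_inv]

end ValueFunction

/-! ### Verification of the regularity conditions from the parameters -/

section Assumptions

lemma aBar_pos_of_params (hlam : 0 ≤ P.lam) (hκ : 0 < P.κ) (hρ : 0 < P.ρ) (hδ : 0 < P.δ) :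
    0 < P.aBar := by
  have h1 : 0 < P.a₁ := by
    have : P.δ * P.ρ < √(P.δ ^ 2 * P.ρ ^ 2 + 4 * P.κ * P.ρ) := by
      refine Real.lt_sqrt_of_sq_lt ?_
      have : 0 < P.κ * P.ρ := by positivity
      nlinarith
    unfold a₁
    linarith
  have h3 : 0 < P.a₃ := by unfold a₃; positivity
  have h4 : P.aBar = P.a₃ ^ 2 / (2 * P.ρ) := by
    have : 2 * P.lam + P.δ ≠ 0 := by positivity
    unfold aBar a₂
    field_simp
    ring
  rw [h4]
  positivity

/-- `γinf` is the nonnegative root of γ² + 2λσ₁²γ − σ₁²σ₂² = −σ₁² f(γ, 0), so the drift is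
nonpositive beyond it. -/
lemma f_nonpos_of_γinf_lt (hlam : 0 ≤ P.lam) (hσ₁ : 0 < P.σ₁) (hγ : P.γinf < P.γmax) :
    0 < P.γmax ∧ P.f P.γmax 0 ≤ 0 := by
  have hsq : (0 : ℝ) ≤ P.lam ^ 2 * P.σ₁ ^ 4 + P.σ₁ ^ 2 * P.σ₂ ^ 2 := by positivity
  have h1 : P.lam * P.σ₁ ^ 2 ≤ √(P.lam ^ 2 * P.σ₁ ^ 4 + P.σ₁ ^ 2 * P.σ₂ ^ 2) := by
    refine Real.le_sqrt_of_sq_le ?_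
    nlinarith [mul_nonneg (sq_nonneg P.σ₁) (sq_nonneg P.σ₂)]
  unfold γinf at hγ
  have hpos : 0 < P.γmax := by linarith
  refine ⟨hpos, ?_⟩
  have h2 : √(P.lam ^ 2 * P.σ₁ ^ 4 + P.σ₁ ^ 2 * P.σ₂ ^ 2) ≤ P.γmax + P.lam * P.σ₁ ^ 2 := by
    linarith
  rw [Real.sqrt_le_left (by positivity)] at h2
  have h3 : P.σ₁ ^ 2 * P.σ₂ ^ 2 ≤ P.γmax ^ 2 + 2 * P.lam * P.γmax * P.σ₁ ^ 2 := by nlinarith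
  have h4 : P.f P.γmax 0 =
      (P.σ₁ ^ 2 * P.σ₂ ^ 2 - (P.γmax ^ 2 + 2 * P.lam * P.γmax * P.σ₁ ^ 2)) / P.σ₁ ^ 2 := by
    unfold f
    field_simp
    ring
  rw [h4]
  exact div_nonpos_of_nonpos_of_nonneg (by linarith) (by positivity)

lemma differentiableOn_cost (hc_convex : StrictConvexOn ℝ (Ici 0) P.c)
    (hc_mono : StrictMonoOn P.c (Ici 0)) (hc_smooth : ContDiffOn ℝ 2 P.c (Ioi 0)) :
    DifferentiableOn ℝ P.c (Ici 0) := by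
  intro x hx
  rcases (mem_Ici.1 hx).eq_or_lt with rfl | hpos
  · exact hc_convex.convexOn.differentiableWithinAt_Ici_zero hc_mono.monotoneOn
  · exact ((hc_smooth.differentiableOn (by norm_num)).differentiableAt
      (Ioi_mem_nhds hpos)).differentiableWithinAt

lemma hmax_nonneg_of_marginal (hd : DifferentiableOn ℝ P.c (Ici 0))
    (hm : ∃ h, 0 ≤ h ∧ P.M₀ ≤ P.marginalCost h) : 0 ≤ P.hmax := by
  unfold hmax
  split_ifs with hlt
  · exact le_rfl
  · rw [not_lt] at hlt
    obtain ⟨h, h0, hh⟩ := hm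
    have hex : ∃ a ∈ Ici (0 : ℝ), P.marginalCost a = P.M₀ := by
      rcases hlt.eq_or_lt with he | hlt
      · exact ⟨0, self_mem_Ici, he⟩
      rcases hh.eq_or_lt with he | hh
      · exact ⟨h, h0, he.symm⟩
      -- Darboux's theorem: derivatives have the intermediate value property, so continuity of c' at
      -- 0 is not needed.
      obtain ⟨a, ha, hae⟩ := exists_hasDerivWithinAt_eq_of_gt_of_lt (f' := P.marginalCost) h0
        (fun x hx => ((hd x hx.1).hasDerivWithinAt).mono Icc_subset_Ici_self) hlt hh
      exact ⟨a, ha.1.le, hae⟩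
    exact Function.invFunOn_mem hex

end Assumptions

end InfoModel

theorem mainTheorem3 (P : InfoModel)
    (hlam : 0 ≤ P.lam) (hσ₁ : 0 < P.σ₁) (hσ₂ : 0 ≤ P.σ₂)
    (hκ : 0 < P.κ) (hρ : 0 < P.ρ) (hδ : 0 < P.δ)
    (hγmax : P.γinf < P.γmax)
    (hc_nonneg : ∀ x, 0 ≤ x → 0 ≤ P.c x)
    (hc_convex : StrictConvexOn ℝ (Set.Ici 0) P.c)
    (hc_mono : StrictMonoOn P.c (Set.Ici 0))
    (hc_smooth : ContDiffOn ℝ 2 P.c (Set.Ioi 0))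
    -- `h_max` is well defined
    (hc_marginal : ∃ h, 0 ≤ h ∧ P.M₀ ≤ P.marginalCost h) :
    -- strict convexity on `[1 / γmax, ∞)`, and on `[1 / γmax, ∞]`
    StrictConvexOn ℝ (Set.Ici (1 / P.γmax)) P.vCheckReal ∧
    StrictConvexOn ℝ≥0 (Set.Ici (ENNReal.ofReal P.γmax)⁻¹) P.vCheck ∧
    -- semiconcavity with linear modulus
    SemiconcaveLinearOn (Set.Ici (1 / P.γmax)) P.vCheckReal ∧
    -- continuous differentiability with Lipschitz derivative
    ContDiffOn ℝ 1 P.vCheckReal (Set.Ioi (1 / P.γmax)) ∧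
    (∃ K : ℝ≥0, LipschitzOnWith K (deriv P.vCheckReal) (Set.Ioi (1 / P.γmax))) ∧
    -- regularity of the original value function
    ContDiffOn ℝ 1 P.v (Set.Ioo 0 P.γmax) ∧
    -- existence and uniqueness of a continuous optimal control
    (∀ γ₀ ∈ Set.Ioc 0 P.γmax, ∃! h : ℝ≥0 → ℝ, Continuous h ∧ P.IsOptimal h γ₀) := by
  have hd := InfoModel.differentiableOn_cost hc_convex hc_mono hc_smooth
  obtain ⟨hγ0, hfγ⟩ := InfoModel.f_nonpos_of_γinf_lt hlam hσ₁ hγmax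
  have hP : P.Regular :=
    { lam_nonneg := hlam
      δ_pos := hδ
      γmax_pos := hγ0
      aBar_pos := InfoModel.aBar_pos_of_params hlam hκ hρ hδ
      hmax_nonneg := InfoModel.hmax_nonneg_of_marginal hd hc_marginal
      f_γmax := hfγ
      c_nonneg := fun x hx => hc_nonneg x hx.1
      c_convex := hc_convex.subset Set.Icc_subset_Ici_self (convex_Icc _ _)
      c_cont := hd.continuousOn.mono Set.Icc_subset_Ici_self }
  refine ⟨InfoModel.strictConvexOn_vCheckReal hP, InfoModel.strictConvexOn_vCheck hP,
    InfoModel.semiconcaveLinearOn_vCheckReal hP, (InfoModel.contDiffOn_vCheckReal hP).1,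
    (InfoModel.contDiffOn_vCheckReal hP).2, InfoModel.contDiffOn_v hP, fun γ₀ hγ₀ => ?_⟩
  obtain ⟨h, hc, hopt⟩ := InfoModel.exists_continuous_isOptimal hP hγ₀
  exact ⟨h, ⟨hc, hopt⟩, fun k hk => hk.2.eq_of_continuous hP hγ₀ hopt hk.1 hc⟩
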